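/- Let $\mathbb A$ be a Cauchy complete category (every idempotent splits), $\mathbf F=(F,m,e)$ a monad on $\mathbb A$, and $\lambda:FF\to FF$ an invertible BD-law, i.e. a natural isomorphism that is a distributive law of $\mathbf F$ over itself and satisfies the Yang--Baxter equation $F\lambda\cdot\lambda F\cdot F\lambda=\lambda F\cdot F\lambda\cdot\lambda F$. Let $F\dashv R$ be an adjunction with unit $\bar\eta$ and counit $\bar\varepsilon$. Let $\mathbf R=(R,\delta,\varepsilon)$ be the induced comonad, where $\delta$ and $\varepsilon$ are the mates of $m$ and $e$, and let $\kappa:RR\to RR$ be the mate of $\lambda$, which is an invertible comonad BD-law on $\mathbf R$. Let $\mathbf F^\lambda=(F,m\cdot\lambda,e)$ be the opposite monad and let $\mathbf F\mathbf F^\lambda$ be the monad on $FF$ with unit $ee$ and multiplication $(m\,m^\lambda)\cdot F\lambda F$, where $m^\lambda=m\cdot\lambda$. Dually, let $\mathbf R^\kappa=(R,\kappa\cdot\delta,\varepsilon)$ be the opposite comonad and let $\mathbf R\mathbf R^\kappa$ be the comonad on $RR$ with counit $\varepsilon\varepsilon$ and comultiplication $R\kappa R\cdot(\delta\,\delta^\kappa)$,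 where $\delta^\kappa=\kappa\cdot\delta$. Further: - $(\mathbf F,\lambda)$ is an Azumaya monad if the comparison functor $\mathbb A\to\mathbb A_{\mathbf F\mathbf F^\lambda}$, $A\mapsto (F(A),\ m_A\cdot F(m_A)\cdot F(\lambda_A))$, is an equivalence; $(\mathbf R,\kappa)$ is an Azumaya comonad if $\mathbb A\to\mathbb A^{\mathbf R\mathbf R^\kappa}$, $A\mapsto(R(A),\ R(\kappa_A)\cdot R(\delta_A)\cdot\delta_A)$, is an equivalence. - A monad $(T,\mu,\eta)$ is separable if $\mu$ has a natural section $\omega:T\to TT$ with $T\mu\cdot\omega T=\omega\cdot\mu=\mu T\cdot T\omega$; separability of a comonad is defined dually. - $\widehat{\mathbf R}$ is the lifting of the comonad $\mathbf R$ to $\mathbb A_{\mathbf F^\lambda}$ given by the mixed distributive law $FR\xrightarrow{\bar\eta}RFFR\xrightarrow{R\lambda^{-1}R}RFFR\xrightarrow{RF\bar\varepsilon}RF$. The free functor $\phi_{\mathbf F^\lambda}:\mathbb A\to\mathbb A_{\mathbf F^\lambda}$ is an $\widehat{\mathbf R}$-comodule functor via $R(m_A)\cdot\bar\eta_{F(A)}$,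 and it is $\widehat{\mathbf R}$-Galois if the induced transformation $\phi_{\mathbf F^\lambda}U_{\mathbf F^\lambda}\to\widehat{\mathbf R}$, with components $R(h)\cdot R(m_A)\cdot\bar\eta_{F(A)}:F(A)\to R(A)$ at $(A,h)\in\mathbb A_{\mathbf F^\lambda}$, is an isomorphism. - $\widetilde{\mathbf F}$ is the lifting of the monad $\mathbf F$ to $\mathbb A^{\mathbf R^\kappa}$ given by the mixed distributive law $FR\xrightarrow{FR\bar\eta}FRRF\xrightarrow{F\kappa^{-1}F}FRRF\xrightarrow{\bar\varepsilon}RF$. The cofree functor $\phi^{\mathbf R^\kappa}:\mathbb A\to\mathbb A^{\mathbf R^\kappa}$ is an $\widetilde{\mathbf F}$-module functor via $\bar\varepsilon_{R(A)}\cdot F(\delta_A)$, and it is $\widetilde{\mathbf F}$-Galois if the induced transformation $\widetilde{\mathbf F}\to\phi^{\mathbf R^\kappa}U^{\mathbf R^\kappa}$, with components $\bar\varepsilon_{R(A)}\cdot F(\delta_A)\cdot F(\theta):F(A)\to R(A)$ at $(A,\theta)\in\mathbb A^{\mathbf R^\kappa}$, is an isomorphism. Then the following are equivalent: (a) $(\mathbf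 F,\lambda)$ is an Azumaya monad and $\mathbf F\mathbf F^\lambda$ is a separable monad; (b) $(\mathbf F,\lambda)$ is an Azumaya monad and $e:1\to F$ is a split monomorphism (of functors); (c) $\phi_{\mathbf F^\lambda}$ is $\widehat{\mathbf R}$-Galois and $e:1\to F$ is a split monomorphism; (d) $(\mathbf R,\kappa)$ is an Azumaya comonad and $\varepsilon:R\to 1$ is a split epimorphism (of functors); (e) $\phi^{\mathbf R^\kappa}$ is $\widetilde{\mathbf F}$-Galois and $\varepsilon:R\to 1$ is a split epimorphism; (f) $(\mathbf R,\kappa)$ is an Azumaya comonad and $\mathbf R\mathbf R^\kappa$ is a separable comonad. -/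

import Mathlib

open CategoryTheory

universe v u

namespace AzumayaMonad

variable {C : Type u} [Category.{v} C]

/-! ### Distributive laws -/

/-- A distributive law `T S ⟶ S T` of a monad `T` over a monad `S`.
(`S ⋙ T` is the functor `X ↦ T (S X)`.) -/
structure DistribLaw (T S : Monad C) where
  hom : S.toFunctor ⋙ T.toFunctor ⟶ T.toFunctor ⋙ S.toFunctor
  unit_left : ∀ X : C, T.η.app (S.obj X) ≫ hom.app X = S.map (T.η.app X)
  unit_right : ∀ X : C, T.map (S.η.app X) ≫ hom.app X = S.η.app (T.obj X)
  mul_right : ∀ X : C, T.map (S.μ.app X) ≫ hom.app X =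
    hom.app (S.obj X) ≫ S.map (hom.app X) ≫ S.μ.app (T.obj X)
  mul_left : ∀ X : C, T.μ.app (S.obj X) ≫ hom.app X =
    T.map (hom.app X) ≫ hom.app (T.obj X) ≫ S.map (T.μ.app X)

/-- A distributive law `H G ⟶ G H` of comonads. -/
structure CodistribLaw (H G : Comonad C) where
  hom : G.toFunctor ⋙ H.toFunctor ⟶ H.toFunctor ⋙ G.toFunctor
  counit_right : ∀ X : C, hom.app X ≫ G.ε.app (H.obj X) = H.map (G.ε.app X)
  counit_left : ∀ X : C, hom.app X ≫ G.map (H.ε.app X) = H.ε.app (G.obj X)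
  comul_right : ∀ X : C, hom.app X ≫ G.δ.app (H.obj X) =
    H.map (G.δ.app X) ≫ hom.app (G.obj X) ≫ G.map (hom.app X)
  comul_left : ∀ X : C, hom.app X ≫ G.map (H.δ.app X) =
    H.δ.app (G.obj X) ≫ H.map (hom.app X) ≫ hom.app (H.obj X)

/-- A mixed distributive law (entwining) `T G ⟶ G T` from a monad `T` to a comonad `G`. -/
structure MixedDistribLaw (T : Monad C) (G : Comonad C) where
  hom : G.toFunctor ⋙ T.toFunctor ⟶ T.toFunctor ⋙ G.toFunctor
  unit : ∀ X : C, T.η.app (G.obj X) ≫ hom.app X = G.map (T.η.app X)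
  counit : ∀ X : C, hom.app X ≫ G.ε.app (T.obj X) = T.map (G.ε.app X)
  mul : ∀ X : C, T.μ.app (G.obj X) ≫ hom.app X =
    T.map (hom.app X) ≫ hom.app (T.obj X) ≫ G.map (T.μ.app X)
  comul : ∀ X : C, hom.app X ≫ G.δ.app (T.obj X) =
    T.map (G.δ.app X) ≫ hom.app (G.obj X) ≫ G.map (hom.app X)

namespace DistribLaw

variable {T S : Monad C} (l : DistribLaw T S)

lemma nat {X Y : C} (f : X ⟶ Y) :
    T.map (S.map f) ≫ l.hom.app Y = l.hom.app X ≫ S.map (T.map f) :=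
  l.hom.naturality f

/-- The composite monad `S T` induced by a distributive law `T S ⟶ S T`. -/
def comp : Monad C where
  toFunctor := T.toFunctor ⋙ S.toFunctor
  η :=
    { app := fun X => T.η.app X ≫ S.η.app (T.obj X)
      naturality := fun X Y f => by
        have h1 := T.unit_naturality _ f
        have h2 := S.unit_naturality _ (T.map f)
        simp only [Functor.id_map, Functor.comp_map, Category.assoc, Functor.id_obj] at *
        rw [reassoc_of% h1, h2] }
  μ :=
    { app := fun X =>
        S.map (l.hom.app (T.obj X)) ≫ S.μ.app (T.obj (T.obj X)) ≫ S.map (T.μ.app X)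
      naturality := fun X Y f => by
        have h1 := congrArg S.map (l.nat (T.map f))
        have h2 := S.mu_naturality _ (T.map (T.map f))
        have h3 := congrArg S.map (T.mu_naturality _ f)
        simp only [Functor.map_comp, Functor.comp_map, Category.assoc, Functor.comp_obj] at *
        rw [reassoc_of% h1, reassoc_of% h2, h3] }
  assoc X := by
    have h1 := congrArg (fun f => S.map f) (l.nat (T.μ.app X))
    have h2 := congrArg (fun f => S.map f) (l.mul_right (T.obj (T.obj X)))
    have h3 := congrArg (fun f => S.map f) (l.nat (l.hom.app (T.obj X)))
    have h4 := congrArg (fun f => S.map f) (l.mul_left (T.obj X))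
    have h5 := S.mu_naturality _ (T.map (T.μ.app X))
    have h6 := S.mu_naturality _ (T.map (l.hom.app (T.obj X)))
    have h7 := S.mu_naturality _ (l.hom.app (T.obj (T.obj X)))
    have h8 := S.mu_naturality _ (T.μ.app (T.obj X))
    have h9 := S.assoc (T.obj (T.obj (T.obj X)))
    have h10 := congrArg S.map (T.assoc X)
    simp only [Functor.map_comp, Functor.comp_map, Category.assoc, Functor.comp_obj] at *
    rw [reassoc_of% h1, reassoc_of% h2, reassoc_of% h3, reassoc_of% h4, reassoc_of% h5, h10,
      reassoc_of% h9, ← reassoc_of% h6, ← reassoc_of% h7, ← reassoc_of% h8]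
  left_unit X := by
    have h1 := congrArg S.map (l.unit_left (T.obj X))
    have h2 := S.unit_naturality _ (l.hom.app (T.obj X))
    have h3 := S.unit_naturality _ (T.η.app (S.obj (T.obj X)))
    have h4 := congrArg S.map (T.left_unit X)
    have h5 := S.unit_naturality _ (S.map (T.η.app (T.obj X)))
    have h6 := l.unit_left (T.obj X)
    simp only [Functor.map_comp, Category.assoc, Functor.comp_obj] at *
    rw [← reassoc_of% h2, reassoc_of% h6, S.left_unit_assoc, h4]
    exact S.map_id _
  right_unit X := by
    have h1 := congrArg S.map (l.unit_right (T.obj X))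
    have h2 := congrArg S.map (T.right_unit X)
    simp only [Functor.map_comp, Functor.comp_map, Category.assoc, Functor.comp_obj] at h1 h2 ⊢
    rw [reassoc_of% h1, S.right_unit_assoc, h2]
    exact S.map_id _

/-- The inverse of an invertible distributive law is a distributive law. -/
noncomputable def inv [IsIso l.hom] : DistribLaw S T where
  hom := CategoryTheory.inv l.hom
  unit_left X := by
    rw [← cancel_mono (l.hom.app X)]
    simp [l.unit_right]
  unit_right X := by
    rw [← cancel_mono (l.hom.app X)]
    simp [l.unit_left]
  mul_right X := by
    rw [← cancel_mono (l.hom.app X)]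
    simp [l.mul_left X]
  mul_left X := by
    rw [← cancel_mono (l.hom.app X)]
    simp [l.mul_right X]

end DistribLaw

namespace CodistribLaw

variable {H G : Comonad C} (k : CodistribLaw H G)

lemma nat {X Y : C} (f : X ⟶ Y) :
    H.map (G.map f) ≫ k.hom.app Y = k.hom.app X ≫ G.map (H.map f) :=
  k.hom.naturality f

/-- The composite comonad `H G` induced by a distributive law `H G ⟶ G H` of comonads. -/
def comp : Comonad C where
  toFunctor := G.toFunctor ⋙ H.toFunctor
  ε :=
    { app := fun X => H.ε.app (G.obj X) ≫ G.ε.app X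
      naturality := fun X Y f => by
        have h1 := G.counit_naturality _ f
        have h2 := H.counit_naturality _ (G.map f)
        simp only [Functor.id_map, Functor.comp_map, Category.assoc, Functor.id_obj] at *
        rw [← h1, reassoc_of% h2] }
  δ :=
    { app := fun X =>
        H.map (G.δ.app X) ≫ H.δ.app (G.obj (G.obj X)) ≫ H.map (k.hom.app (G.obj X))
      naturality := fun X Y f => by
        have h1 := congrArg H.map (k.nat (G.map f))
        have h2 := H.delta_naturality _ (G.map (G.map f))
        have h3 := congrArg H.map (G.delta_naturality _ f)
        simp only [Functor.map_comp, Functor.comp_map, Category.assoc, Functor.comp_obj] at *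
        rw [reassoc_of% h3, reassoc_of% h2, h1] }
  coassoc X := by
    have h1 := congrArg (fun f => H.map f) (k.nat (G.δ.app X))
    have h2 := congrArg (fun f => H.map f) (k.comul_left (G.obj (G.obj X)))
    have h3 := congrArg (fun f => H.map f) (k.nat (k.hom.app (G.obj X)))
    have h4 := congrArg (fun f => H.map f) (k.comul_right (G.obj X))
    have h5 := H.delta_naturality _ (G.map (G.δ.app X))
    have h6 := H.delta_naturality _ (G.map (k.hom.app (G.obj X)))
    have h7 := H.delta_naturality _ (k.hom.app (G.obj (G.obj X)))
    have h8 := H.delta_naturality _ (G.δ.app (G.obj X))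
    have h9 := H.coassoc (G.obj (G.obj (G.obj X)))
    have h10 := congrArg H.map (G.coassoc X)
    simp only [Functor.map_comp, Functor.comp_map, Category.assoc, Functor.comp_obj] at *
    rw [← reassoc_of% h1, ← reassoc_of% h5, reassoc_of% h10, reassoc_of% h2, reassoc_of% h9, ← h3,
      reassoc_of% h4, ← reassoc_of% h8, reassoc_of% h6, reassoc_of% h7]
  left_counit X := by
    have h1 := congrArg H.map (k.counit_left (G.obj X))
    have h2 := congrArg H.map (G.left_counit X)
    simp only [Functor.map_comp, Functor.comp_map, Category.assoc, Functor.comp_obj] at h1 h2 ⊢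
    have h3 := H.counit_naturality _ (k.hom.app (G.obj X))
    simp only [Functor.comp_obj] at h3
    rw [reassoc_of% h3, H.left_counit_assoc, k.counit_right, h2]
    exact H.map_id _
  right_counit X := by
    have h1 := congrArg H.map (k.counit_left (G.obj X))
    have h2 := congrArg H.map (G.right_counit X)
    simp only [Functor.map_comp, Functor.comp_map, Category.assoc, Functor.comp_obj] at h1 h2 ⊢
    rw [reassoc_of% h1, H.right_counit_assoc, h2]
    exact H.map_id _

/-- The inverse of an invertible distributive law of comonads is a distributive law. -/
noncomputable def inv [IsIso k.hom] : CodistribLaw G H where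
  hom := CategoryTheory.inv k.hom
  counit_right X := by
    rw [← cancel_epi (k.hom.app X)]
    simp [k.counit_left]
  counit_left X := by
    rw [← cancel_epi (k.hom.app X)]
    simp [k.counit_right]
  comul_right X := by
    rw [← cancel_epi (k.hom.app X)]
    simp [reassoc_of% (k.comul_left X)]
  comul_left X := by
    rw [← cancel_epi (k.hom.app X)]
    simp [reassoc_of% (k.comul_right X)]

end CodistribLaw

/-! ### Adjoint pairs consisting of a monad and a comonad -/

/-- A monad `T` and a comonad `G` with `T ⊣ G`, the structure maps of `G` being the mates of
those of `T`. -/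
structure AdjointPair (T : Monad C) (G : Comonad C) where
  adj : T.toFunctor ⊣ G.toFunctor
  counit_mate : G.ε = conjugateEquiv adj Adjunction.id T.η
  comul_mate : G.δ = conjugateEquiv adj (adj.comp adj) T.μ

section Adj

variable {T : Monad C} {R : C ⥤ C} (adj : T.toFunctor ⊣ R)

lemma adj_ext {Y X : C} {f g : Y ⟶ R.obj X}
    (h : T.map f ≫ adj.counit.app X = T.map g ≫ adj.counit.app X) : f = g := by
  apply (adj.homEquiv Y X).symm.injective
  simpa [Adjunction.homEquiv_counit] using h

lemma adj_ext' {Y X : C} {f g : T.obj Y ⟶ X}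
    (h : adj.unit.app Y ≫ R.map f = adj.unit.app Y ≫ R.map g) : f = g := by
  apply (adj.homEquiv Y X).injective
  simpa [Adjunction.homEquiv_unit] using h

lemma adj_counit_nat {X Y : C} (f : X ⟶ Y) :
    T.map (R.map f) ≫ adj.counit.app Y = adj.counit.app X ≫ f :=
  adj.counit.naturality f

lemma adj_unit_nat {X Y : C} (f : X ⟶ Y) :
    f ≫ adj.unit.app Y = adj.unit.app X ≫ R.map (T.map f) :=
  adj.unit.naturality f

lemma adj_ext_two {Y X : C} {f g : Y ⟶ R.obj (R.obj X)}
    (h : T.map (T.map f) ≫ T.map (adj.counit.app (R.obj X)) ≫ adj.counit.app X =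
      T.map (T.map g) ≫ T.map (adj.counit.app (R.obj X)) ≫ adj.counit.app X) : f = g := by
  apply adj_ext adj
  apply adj_ext adj
  simpa using h

lemma adj_ext_three {Y X : C} {f g : Y ⟶ R.obj (R.obj (R.obj X))}
    (h : T.map (T.map (T.map f)) ≫ T.map (T.map (adj.counit.app (R.obj (R.obj X)))) ≫
        T.map (adj.counit.app (R.obj X)) ≫ adj.counit.app X =
      T.map (T.map (T.map g)) ≫ T.map (T.map (adj.counit.app (R.obj (R.obj X)))) ≫
        T.map (adj.counit.app (R.obj X)) ≫ adj.counit.app X) : f = g := by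
  apply adj_ext adj
  apply adj_ext_two adj
  simpa using h

lemma mate_counit_app (X : C) :
    (conjugateEquiv adj Adjunction.id T.η).app X =
      T.η.app (R.obj X) ≫ adj.counit.app X := by
  simp [conjugateEquiv_apply_app]

lemma mate_comul_counit (X : C) :
    T.map (T.map ((conjugateEquiv adj (adj.comp adj) T.μ).app X)) ≫
      T.map (adj.counit.app (R.obj X)) ≫ adj.counit.app X =
      T.μ.app (R.obj X) ≫ adj.counit.app X := by
  have := conjugateEquiv_counit adj (adj.comp adj) T.μ X
  simpa using this

lemma mate_hom_counit (f : T.toFunctor ⋙ T.toFunctor ⟶ T.toFunctor ⋙ T.toFunctor) (X : C) :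
    T.map (T.map ((conjugateEquiv (adj.comp adj) (adj.comp adj) f).app X)) ≫
      T.map (adj.counit.app (R.obj X)) ≫ adj.counit.app X =
      f.app (R.obj (R.obj X)) ≫ T.map (adj.counit.app (R.obj X)) ≫ adj.counit.app X := by
  have := conjugateEquiv_counit (adj.comp adj) (adj.comp adj) f X
  simpa using this

/-- The comonad on a right adjoint `R` of (the functor of) a monad `T`, whose counit and
comultiplication are the mates of the unit and the multiplication of `T`. -/
def rightAdjointComonad : Comonad C where
  toFunctor := R
  ε := conjugateEquiv adj Adjunction.id T.η
  δ := conjugateEquiv adj (adj.comp adj) T.μ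
  coassoc X := by
    have a := mate_comul_counit adj X
    have b := mate_comul_counit adj (R.obj X)
    generalize hd : conjugateEquiv adj (adj.comp adj) T.μ = d at *
    have h1 := congrArg (fun f => T.map (T.map f)) (adj_counit_nat adj (d.app X))
    have h2 := T.mu_naturality _ (adj.counit.app (R.obj X))
    have h3 := T.mu_naturality _ (T.map (d.app X))
    have h4 := congrArg T.map b
    have h5 := congrArg T.map (T.mu_naturality _ (d.app X))
    have h6 := T.assoc (R.obj X)
    apply adj_ext_three adj
    simp only [Functor.map_comp, Category.assoc, Functor.comp_obj, Functor.comp_map,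
      Functor.id_obj] at *
    rw [reassoc_of% h1, a, reassoc_of% h2, reassoc_of% h3, a, reassoc_of% h4,
      reassoc_of% h5, a, reassoc_of% h6]
  left_counit X := by
    have a := mate_comul_counit adj X
    have b := mate_counit_app adj (R.obj X)
    generalize hd : conjugateEquiv adj (adj.comp adj) T.μ = d at *
    have h1 := congrArg T.map (T.unit_naturality _ (d.app X))
    apply adj_ext adj
    simp only [Functor.map_comp, Category.assoc, Functor.comp_obj, Functor.comp_map,
      Functor.id_obj] at *
    rw [b]
    simp only [Functor.map_comp, Category.assoc]
    rw [reassoc_of% h1, a, T.right_unit_assoc]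
    simp
  right_counit X := by
    have a := mate_comul_counit adj X
    have b := mate_counit_app adj X
    generalize hd : conjugateEquiv adj (adj.comp adj) T.μ = d at *
    have h1 := T.unit_naturality _ (T.map (d.app X))
    have h2 := T.unit_naturality _ (adj.counit.app (R.obj X))
    have h3 := adj_counit_nat adj (T.η.app (R.obj X) ≫ adj.counit.app X)
    apply adj_ext adj
    simp only [Functor.map_comp, Category.assoc, Functor.comp_obj, Functor.comp_map,
      Functor.id_obj] at *
    rw [b]
    simp only [Functor.map_comp, Category.assoc]
    rw [h3, reassoc_of% h2, reassoc_of% h1, a, T.left_unit_assoc]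
    simp

/-- A monad and its right adjoint comonad form an adjoint pair. -/
def AdjointPair.ofAdj : AdjointPair T (rightAdjointComonad adj) where
  adj := adj
  counit_mate := rfl
  comul_mate := rfl

end Adj

namespace AdjointPair

variable {T : Monad C} {G : Comonad C} (p : AdjointPair T G)

lemma counit_eq (X : C) : G.ε.app X = T.η.app (G.obj X) ≫ p.adj.counit.app X := by
  rw [p.counit_mate, mate_counit_app]

lemma unit_eq (X : C) : T.η.app X = p.adj.unit.app X ≫ G.ε.app (T.obj X) := by
  rw [p.counit_eq]
  have h := T.unit_naturality _ (p.adj.unit.app X)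
  simp only [Functor.id_obj, Functor.comp_obj] at h
  rw [reassoc_of% h, p.adj.left_triangle_components]
  simp

lemma comul_counit (X : C) :
    T.map (T.map (G.δ.app X)) ≫ T.map (p.adj.counit.app (G.obj X)) ≫ p.adj.counit.app X =
      T.μ.app (G.obj X) ≫ p.adj.counit.app X := by
  rw [p.comul_mate, mate_comul_counit]

lemma unit_comul (X : C) :
    p.adj.unit.app X ≫ G.δ.app (T.obj X) =
      p.adj.unit.app X ≫ G.map (p.adj.unit.app (T.obj X)) ≫ G.map (G.map (T.μ.app X)) := by
  have := unit_conjugateEquiv p.adj (p.adj.comp p.adj) T.μ X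
  rw [p.comul_mate]
  simpa using this

end AdjointPair

/-! ### Mixed distributive laws from distributive laws and adjunctions -/

/-- For a distributive law `λ : T S ⟶ S T` of monads and `T ⊣ G`, the composite
`S G ⟶ G T S G ⟶ G S T G ⟶ G S` is a mixed distributive law from `S` to `G`. -/
def DistribLaw.mate {T S : Monad C} (l : DistribLaw T S) {G : Comonad C} (p : AdjointPair T G) :
    MixedDistribLaw S G :=
  let w : G.toFunctor ⋙ S.toFunctor ⟶ S.toFunctor ⋙ G.toFunctor :=
    { app := fun X =>
        p.adj.unit.app (S.obj (G.obj X)) ≫ G.map (l.hom.app (G.obj X)) ≫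
          G.map (S.map (p.adj.counit.app X))
      naturality := fun X Y f => by
        have h1 := adj_unit_nat p.adj (S.map (G.map f))
        have h2 := congrArg G.map (l.nat (G.map f))
        have h3 := congrArg (fun f => G.map (S.map f)) (adj_counit_nat p.adj f)
        simp only [Functor.map_comp, Functor.comp_map, Category.assoc, Functor.comp_obj] at *
        rw [reassoc_of% h1, reassoc_of% h2, h3] }
  have hw : ∀ X : C, T.map (w.app X) ≫ p.adj.counit.app (S.obj X) =
      l.hom.app (G.obj X) ≫ S.map (p.adj.counit.app X) := fun X => by
    simp [w, adj_counit_nat]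
  { hom := w
    unit := fun X => by
      have h1 := hw X
      generalize w = w at *
      apply adj_ext p.adj
      have h2 := l.unit_right (G.obj X)
      have h3 := S.unit_naturality _ (p.adj.counit.app X)
      simp only [Functor.map_comp, Category.assoc, Functor.comp_obj, Functor.id_obj] at *
      rw [h1, reassoc_of% h2, ← h3, adj_counit_nat]
    counit := fun X => by
      have h1 := hw X
      generalize w = w at *
      have h2 := T.unit_naturality _ (w.app X)
      have h3 := l.unit_left (G.obj X)
      simp only [Functor.comp_obj, Functor.id_obj] at *
      rw [p.counit_eq, p.counit_eq, reassoc_of% h2, h1, reassoc_of% h3, S.map_comp]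
    mul := fun X => by
      have h1 := hw X
      have h1' := hw (S.obj X)
      generalize w = w at *
      apply adj_ext p.adj
      have h2 := l.mul_right (G.obj X)
      have h3 := adj_counit_nat p.adj (S.μ.app X)
      have h4 := l.nat (w.app X)
      have h5 := congrArg S.map h1
      have h6 := S.mu_naturality _ (p.adj.counit.app X)
      simp only [Functor.map_comp, Category.assoc, Functor.comp_obj, Functor.id_obj] at *
      rw [h1, reassoc_of% h2, h3, reassoc_of% h1', reassoc_of% h4, reassoc_of% h5, h6]
    comul := fun X => by
      have h1 := hw X
      have h1' := congrArg T.map (hw (G.obj X))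
      generalize w = w at *
      apply adj_ext_two p.adj
      have h2 := p.comul_counit (S.obj X)
      have h3 := T.mu_naturality _ (w.app X)
      have h4 := l.mul_left (G.obj X)
      have h5 := congrArg T.map (adj_counit_nat p.adj (w.app X))
      have h6 := l.nat (p.adj.counit.app (G.obj X))
      have h7 := congrArg T.map (l.nat (G.δ.app X))
      have h8 := l.nat (T.map (G.δ.app X))
      have h9 := congrArg S.map (p.comul_counit X)
      simp only [Functor.map_comp, Category.assoc, Functor.comp_obj, Functor.id_obj] at *
      rw [h2, reassoc_of% h3, h1, reassoc_of% h4, reassoc_of% h5, h1, reassoc_of% h1',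
        reassoc_of% h6, reassoc_of% h7, reassoc_of% h8, h9] }

lemma DistribLaw.mate_counit {T S : Monad C} (l : DistribLaw T S) {G : Comonad C}
    (p : AdjointPair T G) (X : C) :
    T.map ((l.mate p).hom.app X) ≫ p.adj.counit.app (S.obj X) =
      l.hom.app (G.obj X) ≫ S.map (p.adj.counit.app X) := by
  simp [DistribLaw.mate, adj_counit_nat]

/-- For a distributive law `κ : H G ⟶ G H` of comonads and `L ⊣ G`, the composite
`L H ⟶ L H G L ⟶ L G H L ⟶ H L` is a mixed distributive law from `L` to `H`. -/
def CodistribLaw.mate {H G : Comonad C} (k : CodistribLaw H G) {L : Monad C}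
    (p : AdjointPair L G) : MixedDistribLaw L H :=
  let w : H.toFunctor ⋙ L.toFunctor ⟶ L.toFunctor ⋙ H.toFunctor :=
    { app := fun X =>
        L.map (H.map (p.adj.unit.app X)) ≫ L.map (k.hom.app (L.obj X)) ≫
          p.adj.counit.app (H.obj (L.obj X))
      naturality := fun X Y f => by
        have h1 := congrArg (fun f => L.map (H.map f)) (adj_unit_nat p.adj f)
        have h2 := congrArg L.map (k.nat (L.map f))
        have h3 := adj_counit_nat p.adj (H.map (L.map f))
        simp only [Functor.map_comp, Functor.comp_map, Category.assoc, Functor.comp_obj] at *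
        rw [reassoc_of% h1, reassoc_of% h2, h3] }
  have hw : ∀ X : C, p.adj.unit.app (H.obj X) ≫ G.map (w.app X) =
      H.map (p.adj.unit.app X) ≫ k.hom.app (L.obj X) := fun X => by
    have h1 := adj_unit_nat p.adj (H.map (p.adj.unit.app X))
    have h2 := adj_unit_nat p.adj (k.hom.app (L.obj X))
    simp only [w, Functor.map_comp, Category.assoc, Functor.comp_obj, Functor.id_obj] at *
    rw [← reassoc_of% h1, ← reassoc_of% h2, p.adj.right_triangle_components]
    simp
  { hom := w
    unit := fun X => by
      have h1 := hw X
      generalize w = w at *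
      have h2 := G.counit_naturality _ (w.app X)
      have h3 := k.counit_right (L.obj X)
      simp only [Functor.comp_obj, Functor.id_obj] at *
      rw [p.unit_eq, p.unit_eq, Category.assoc, ← h2, reassoc_of% h1, h3, H.map_comp]
    counit := fun X => by
      have h1 := hw X
      generalize w = w at *
      apply adj_ext' p.adj
      have h2 := k.counit_left (L.obj X)
      have h3 := H.counit_naturality _ (p.adj.unit.app X)
      have h4 := adj_unit_nat p.adj (H.ε.app X)
      simp only [Functor.map_comp, Category.assoc, Functor.comp_obj, Functor.id_obj] at *
      rw [reassoc_of% h1, h2, h3, h4]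
    mul := fun X => by
      have h1 := hw X
      have h1' := congrArg G.map (hw (L.obj X))
      generalize w = w at *
      apply adj_ext' p.adj
      apply adj_ext' p.adj
      have h2 := p.unit_comul (H.obj X)
      have h3 := G.delta_naturality _ (w.app X)
      have h4 := k.comul_right (L.obj X)
      have h5 := congrArg G.map (adj_unit_nat p.adj (w.app X))
      have h6 := congrArg H.map (p.unit_comul X)
      have h7 := k.nat (p.adj.unit.app (L.obj X))
      have h8 := k.nat (G.map (L.map (p.adj.unit.app X)))
      have h9 := k.nat (G.map (L.μ.app X))
      have h10 := congrArg G.map (k.nat (L.μ.app X))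
      simp only [Functor.map_comp, Category.assoc, Functor.comp_obj, Functor.id_obj] at *
      rw [← reassoc_of% h2, ← h3, reassoc_of% h1, h4, reassoc_of% h6, ← reassoc_of% h5,
        reassoc_of% h1, reassoc_of% h1', ← reassoc_of% h7, ← h10, reassoc_of% h9]
    comul := fun X => by
      have h1 := hw X
      have h1' := hw (H.obj X)
      generalize w = w at *
      apply adj_ext' p.adj
      have h2 := k.comul_left (L.obj X)
      have h3 := congrArg G.map (k.nat (p.adj.unit.app X))
      have h4 := adj_unit_nat p.adj (H.δ.app X)
      have h5 := H.delta_naturality _ (p.adj.unit.app X)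
      have h6 := congrArg H.map h1
      have h7 := k.nat (w.app X)
      simp only [Functor.map_comp, Category.assoc, Functor.comp_obj, Functor.id_obj] at *
      rw [reassoc_of% h1, h2, reassoc_of% h5, ← reassoc_of% h4, reassoc_of% h1', ← h7,
        reassoc_of% h6] }

lemma CodistribLaw.mate_unit {H G : Comonad C} (k : CodistribLaw H G) {L : Monad C}
    (p : AdjointPair L G) (X : C) :
    p.adj.unit.app (H.obj X) ≫ G.map ((k.mate p).hom.app X) =
      H.map (p.adj.unit.app X) ≫ k.hom.app (L.obj X) := by
  have h1 := adj_unit_nat p.adj (H.map (p.adj.unit.app X))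
  have h2 := adj_unit_nat p.adj (k.hom.app (L.obj X))
  simp only [CodistribLaw.mate, Functor.map_comp, Functor.comp_obj, Functor.id_obj] at *
  rw [← reassoc_of% h1, ← reassoc_of% h2, p.adj.right_triangle_components]
  simp

namespace MixedDistribLaw

variable {T : Monad C} {G : Comonad C} (w : MixedDistribLaw T G)

lemma nat {X Y : C} (f : X ⟶ Y) :
    T.map (G.map f) ≫ w.hom.app Y = w.hom.app X ≫ G.map (T.map f) :=
  w.hom.naturality f

/-- The lifting of the comonad `G` to the category of `T`-modules. -/
def liftComonad : Comonad T.Algebra where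
  obj M :=
    { A := G.obj M.A
      a := w.hom.app M.A ≫ G.map M.a
      unit := by
        have h := congrArg G.map M.unit
        simp only [Functor.map_comp] at h
        rw [reassoc_of% (w.unit M.A), h]
        exact G.map_id _
      assoc := by
        have h1 := congrArg G.map M.assoc
        have h2 := w.nat M.a
        simp only [Functor.map_comp, Category.assoc] at *
        rw [reassoc_of% (w.mul M.A), h1, reassoc_of% h2] }
  map {M N} f :=
    { f := G.map f.f
      h := by
        have h1 := w.nat f.f
        have h2 := congrArg G.map f.h
        simp only [Functor.map_comp, Category.assoc] at *
        rw [reassoc_of% h1, h2] }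
  ε :=
    { app := fun M =>
        { f := G.ε.app M.A
          h := by
            have h1 := G.counit_naturality _ M.a
            have h2 := w.counit M.A
            dsimp
            rw [Category.assoc, h1, reassoc_of% h2] }
      naturality := fun M N f => by
        ext
        exact G.ε.naturality f.f }
  δ :=
    { app := fun M =>
        { f := G.δ.app M.A
          h := by
            have h1 := G.delta_naturality _ M.a
            have h2 := w.comul M.A
            dsimp
            rw [Category.assoc, h1, reassoc_of% h2]
            simp }
      naturality := fun M N f => by
        ext
        exact G.δ.naturality f.f }
  coassoc M := by ext; exact G.coassoc M.A
  left_counit M := by ext; exact G.left_counit M.A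
  right_counit M := by ext; exact G.right_counit M.A

/-- The lifting of the monad `T` to the category of `G`-comodules. -/
def liftMonad : Monad G.Coalgebra where
  obj M :=
    { A := T.obj M.A
      a := T.map M.a ≫ w.hom.app M.A
      counit := by
        have h := congrArg T.map M.counit
        simp only [Functor.map_comp] at h
        rw [Category.assoc, w.counit M.A, h]
        exact T.map_id _
      coassoc := by
        have h1 := congrArg T.map M.coassoc
        have h2 := w.nat M.a
        simp only [Functor.map_comp, Category.assoc] at *
        rw [w.comul M.A, reassoc_of% h1, reassoc_of% h2] }
  map {M N} f :=
    { f := T.map f.f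
      h := by
        have h1 := w.nat f.f
        have h2 := congrArg T.map f.h
        simp only [Functor.map_comp, Category.assoc] at *
        rw [← h1, reassoc_of% h2] }
  η :=
    { app := fun M =>
        { f := T.η.app M.A
          h := by
            have h1 := T.unit_naturality _ M.a
            have h2 := w.unit M.A
            dsimp
            rw [← reassoc_of% h1, h2] }
      naturality := fun M N f => by
        ext
        exact T.η.naturality f.f }
  μ :=
    { app := fun M =>
        { f := T.μ.app M.A
          h := by
            have h1 := T.mu_naturality _ M.a
            have h2 := w.mul M.A
            dsimp
            rw [← reassoc_of% h1, h2]
            simp }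
      naturality := fun M N f => by
        ext
        exact T.μ.naturality f.f }
  assoc M := by ext; exact T.assoc M.A
  left_unit M := by ext; exact T.left_unit M.A
  right_unit M := by ext; exact T.right_unit M.A

end MixedDistribLaw

/-! ### Galois (co)module functors -/

universe w z

section Galois

variable {B : Type z} [Category.{w} B]

/-- A left `G`-comodule structure on a functor `L`, for a comonad `G`. -/
structure Coaction (G : Comonad C) (L : B ⥤ C) where
  hom : L ⟶ L ⋙ G.toFunctor
  counit : ∀ X : B, hom.app X ≫ G.ε.app (L.obj X) = 𝟙 (L.obj X)
  coassoc : ∀ X : B, hom.app X ≫ G.δ.app (L.obj X) = hom.app X ≫ G.map (hom.app X)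

/-- For a left `G`-comodule functor `L` with right adjoint `S`, the natural transformation
`L S ⟶ G L S ⟶ G`. -/
def Coaction.galoisMap {G : Comonad C} {L : B ⥤ C} (a : Coaction G L) {S : C ⥤ B} (adj : L ⊣ S) :
    S ⋙ L ⟶ G.toFunctor where
  app X := a.hom.app (S.obj X) ≫ G.map (adj.counit.app X)
  naturality X Y f := by
    have h1 := a.hom.naturality (S.map f)
    have h2 := congrArg G.map (adj.counit.naturality f)
    simp only [Functor.map_comp, Functor.comp_map, Category.assoc, Functor.id_map] at *
    rw [reassoc_of% h1, h2]

/-- A left `T`-module structure on a functor `R`, for a monad `T`. -/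
structure Action (T : Monad C) (R : B ⥤ C) where
  hom : R ⋙ T.toFunctor ⟶ R
  unit : ∀ X : B, T.η.app (R.obj X) ≫ hom.app X = 𝟙 (R.obj X)
  assoc : ∀ X : B, T.μ.app (R.obj X) ≫ hom.app X = T.map (hom.app X) ≫ hom.app X

/-- For a left `T`-module functor `R` with left adjoint `L`, the natural transformation
`T ⟶ T R L ⟶ R L`. -/
def Action.galoisMap {T : Monad C} {R : B ⥤ C} (a : Action T R) {L : C ⥤ B} (adj : L ⊣ R) :
    T.toFunctor ⟶ L ⋙ R where
  app X := T.map (adj.unit.app X) ≫ a.hom.app (L.obj X)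
  naturality X Y f := by
    have h1 := a.hom.naturality (L.map f)
    have h2 := congrArg T.map (adj.unit.naturality f)
    simp only [Functor.map_comp, Functor.comp_map, Category.assoc, Functor.id_map] at *
    rw [reassoc_of% h2, h1]

end Galois

/-! ### BD-laws, opposite monads and Azumaya monads -/

/-- A (monad) BD-law: a distributive law `F F ⟶ F F` satisfying the Yang-Baxter equation. -/
structure BDLaw (F : Monad C) extends DistribLaw F F where
  yang_baxter : ∀ X : C,
    F.map (hom.app X) ≫ hom.app (F.obj X) ≫ F.map (hom.app X) =
      hom.app (F.obj X) ≫ F.map (hom.app X) ≫ hom.app (F.obj X)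

/-- A comonad BD-law. -/
structure CoBDLaw (G : Comonad C) extends CodistribLaw G G where
  yang_baxter : ∀ X : C,
    G.map (hom.app X) ≫ hom.app (G.obj X) ≫ G.map (hom.app X) =
      hom.app (G.obj X) ≫ G.map (hom.app X) ≫ hom.app (G.obj X)

/-- A monad is separable if its multiplication `m` has a natural section `ω` with
`F m · ω F = ω · m = m F · F ω`. -/
def IsSeparableMonad (T : Monad C) : Prop :=
  ∃ ω : T.toFunctor ⟶ T.toFunctor ⋙ T.toFunctor,
    (∀ X : C, ω.app X ≫ T.μ.app X = 𝟙 (T.obj X)) ∧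
    (∀ X : C, ω.app (T.obj X) ≫ T.map (T.μ.app X) = T.μ.app X ≫ ω.app X) ∧
    (∀ X : C, T.map (ω.app X) ≫ T.μ.app (T.obj X) = T.μ.app X ≫ ω.app X)

/-- A comonad is separable if its comultiplication `δ` has a natural retraction `ϱ` with
`ϱ G · G δ = δ · ϱ = G ϱ · δ G`. -/
def IsSeparableComonad (G : Comonad C) : Prop :=
  ∃ ϱ : G.toFunctor ⋙ G.toFunctor ⟶ G.toFunctor,
    (∀ X : C, G.δ.app X ≫ ϱ.app X = 𝟙 (G.obj X)) ∧
    (∀ X : C, G.map (G.δ.app X) ≫ ϱ.app (G.obj X) = ϱ.app X ≫ G.δ.app X) ∧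
    (∀ X : C, G.δ.app (G.obj X) ≫ G.map (ϱ.app X) = ϱ.app X ≫ G.δ.app X)

namespace BDLaw

variable {F : Monad C} (l : BDLaw F)

/-- The opposite monad `F^λ`, with multiplication `m · λ`. -/
def opp : Monad C where
  toFunctor := F.toFunctor
  η := F.η
  μ := l.hom ≫ F.μ
  assoc X := by
    have h1 := l.mul_left X
    have h2 := l.mul_right X
    have h3 := l.yang_baxter X
    have h4 := F.assoc X
    simp only [Functor.map_comp, Category.assoc, NatTrans.comp_app] at *
    rw [reassoc_of% h2, reassoc_of% h1, reassoc_of% h3, h4]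
  left_unit X := by
    simp [reassoc_of% (l.unit_left X)]
  right_unit X := by
    simp [reassoc_of% (l.unit_right X)]

/-- The BD-law as a distributive law `F^λ F ⟶ F F^λ`. -/
def oppLaw : DistribLaw l.opp F where
  hom := l.hom
  unit_left := l.unit_left
  unit_right := l.unit_right
  mul_right := l.mul_right
  mul_left X := by
    have h1 := l.mul_left X
    have h2 := l.yang_baxter X
    simp only [opp, Functor.map_comp, Category.assoc, NatTrans.comp_app] at *
    rw [h1, reassoc_of% h2]

/-- The monad `F F^λ`. -/
def double : Monad C := l.oppLaw.comp

/-- The comparison functor from `C` to the category of `F F^λ`-modules. -/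
def comparison : C ⥤ l.double.Algebra where
  obj X :=
    { A := F.obj X
      a := F.map (l.hom.app X) ≫ F.map (F.μ.app X) ≫ F.μ.app X
      unit := by
        have h1 := F.unit_naturality _ (l.hom.app X ≫ F.μ.app X)
        have h2 := l.unit_left X
        simp only [double, DistribLaw.comp, opp, Functor.map_comp, Category.assoc,
          Functor.id_obj, Functor.comp_obj] at *
        rw [← reassoc_of% h1, reassoc_of% h2, F.right_unit_assoc, F.left_unit]
        rfl
      assoc := by
        have h1 := congrArg F.map (l.opp.assoc X)
        have h2 := F.mu_naturality _ (F.map (l.hom.app X ≫ F.μ.app X))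
        have h3 := F.mu_naturality _ (l.hom.app X ≫ F.μ.app X)
        have h4 := congrArg F.map (l.mul_right X)
        have h5 := congrArg F.map (l.nat (l.hom.app X ≫ F.μ.app X))
        have h6 := congrArg F.map (F.assoc X)
        have h7 := F.assoc X
        simp only [double, DistribLaw.comp, opp, oppLaw, Functor.map_comp, Category.assoc,
          Functor.comp_map, NatTrans.comp_app, Functor.comp_obj] at *
        rw [reassoc_of% h4, reassoc_of% h5, ← reassoc_of% h6, h7, reassoc_of% h3,
          reassoc_of% h2, reassoc_of% h1, h7] }
  map f :=
    { f := F.map f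
      h := by
        have h1 := congrArg F.map (l.nat f)
        have h2 := congrArg F.map (F.mu_naturality _ f)
        have h3 := F.mu_naturality _ f
        simp only [double, DistribLaw.comp, opp, Functor.map_comp, Category.assoc,
          Functor.comp_map, Functor.comp_obj] at *
        rw [reassoc_of% h1, reassoc_of% h2, h3] }

/-- `(F, λ)` is an Azumaya monad. -/
def IsAzumaya : Prop := l.comparison.IsEquivalence

section RightAdjoint

variable [hl : IsIso l.hom]

instance : IsIso l.oppLaw.hom := hl

variable {R : Comonad C} (p : AdjointPair F R)

/-- The mixed distributive law from `F^λ` to the right adjoint comonad `R` of `F`, induced by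
`λ⁻¹ : F F^λ ⟶ F^λ F`. -/
noncomputable def mixed : MixedDistribLaw l.opp R := l.oppLaw.inv.mate p

/-- The lifting of the right adjoint comonad `R` of `F` to the category of `F^λ`-modules. -/
noncomputable def liftComonad : Comonad l.opp.Algebra := (l.mixed p).liftComonad

lemma freeCoaction_aux (w : R.toFunctor ⋙ F.toFunctor ⟶ F.toFunctor ⋙ R.toFunctor)
    (hw : ∀ X : C, F.map (w.app X) ≫ p.adj.counit.app (F.obj X) =
      (CategoryTheory.inv l.hom).app (R.obj X) ≫ F.map (p.adj.counit.app X)) (X : C) :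
    F.map (p.adj.unit.app (F.obj X) ≫ R.map (F.μ.app X)) ≫ w.app (F.obj X) ≫
        R.map (l.hom.app X ≫ F.μ.app X) =
      (l.hom.app X ≫ F.μ.app X) ≫ p.adj.unit.app (F.obj X) ≫ R.map (F.μ.app X) := by
  have h1 := hw (F.obj X)
  have h2 : F.map (p.adj.unit.app (F.obj X) ≫ R.map (F.μ.app X)) ≫
      p.adj.counit.app (F.obj X) = F.μ.app X := by simp
  have h3 := (CategoryTheory.inv l.hom).naturality
    (p.adj.unit.app (F.obj X) ≫ R.map (F.μ.app X))
  have h4 := adj_counit_nat p.adj (l.hom.app X ≫ F.μ.app X)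
  have h5 := congrArg F.map h2
  have h6 := l.mul_right X
  have h7 : F.map (l.hom.app X) ≫ F.map (F.μ.app X) ≫ F.μ.app X =
      (CategoryTheory.inv l.hom).app (F.obj X) ≫ F.map (F.μ.app X) ≫ l.hom.app X ≫
        F.μ.app X := by
    rw [reassoc_of% h6, F.assoc]
    simp
  generalize p.adj.unit.app (F.obj X) ≫ R.map (F.μ.app X) = α at *
  apply adj_ext p.adj
  simp only [Functor.map_comp, Category.assoc, Functor.comp_obj, Functor.id_obj,
    Functor.comp_map] at *
  rw [h2, h4, reassoc_of% h1, reassoc_of% h3, reassoc_of% h5, h7]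

/-- The comodule structure, over the lifting of `R`, on the free functor of `F^λ`; its
components are `F A ⟶ R F F A ⟶ R F A`. -/
noncomputable def freeCoaction : Coaction (l.liftComonad p) l.opp.free where
  hom :=
    { app := fun X =>
        { f := p.adj.unit.app (F.obj X) ≫ R.map (F.μ.app X)
          h := by
            exact l.freeCoaction_aux p (l.mixed p).hom (l.oppLaw.inv.mate_counit p) X }
      naturality := fun X Y f => by
        ext
        have h1 := adj_unit_nat p.adj (F.map f)
        have h2 := congrArg R.map (F.mu_naturality _ f)
        simp only [Functor.map_comp, Category.assoc] at *
        change F.map f ≫ p.adj.unit.app (F.obj Y) ≫ R.map (F.μ.app Y) =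
          (p.adj.unit.app (F.obj X) ≫ R.map (F.μ.app X)) ≫ R.map (F.map f)
        rw [reassoc_of% h1, h2, Category.assoc] }
  counit X := by
    ext
    change (p.adj.unit.app (F.obj X) ≫ R.map (F.μ.app X)) ≫ R.ε.app (F.obj X) = 𝟙 (F.obj X)
    have h1 := R.counit_naturality _ (F.μ.app X)
    have h2 := p.unit_eq (F.obj X)
    simp only [Functor.comp_obj] at h1
    rw [Category.assoc, h1, ← reassoc_of% h2, F.left_unit]
    rfl
  coassoc X := by
    ext
    change (p.adj.unit.app (F.obj X) ≫ R.map (F.μ.app X)) ≫ R.δ.app (F.obj X) =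
      (p.adj.unit.app (F.obj X) ≫ R.map (F.μ.app X)) ≫
        R.map (p.adj.unit.app (F.obj X) ≫ R.map (F.μ.app X))
    have h1 := R.delta_naturality _ (F.μ.app X)
    have h2 := p.unit_comul (F.obj X)
    have h3 := congrArg (fun f => R.map (R.map f)) (F.assoc X)
    have h4 := congrArg R.map (adj_unit_nat p.adj (F.μ.app X))
    simp only [Functor.map_comp, Category.assoc, Functor.comp_obj] at *
    rw [h1, reassoc_of% h2, ← h3, reassoc_of% h4]

/-- The free functor of `F^λ` is Galois with respect to the lifting of `R`. -/
def FreeIsGalois : Prop := IsIso ((l.freeCoaction p).galoisMap l.opp.adj)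

end RightAdjoint

end BDLaw

namespace CoBDLaw

variable {G : Comonad C} (k : CoBDLaw G)

/-- The opposite comonad `G^κ`, with comultiplication `κ · δ`. -/
def opp : Comonad C where
  toFunctor := G.toFunctor
  ε := G.ε
  δ := G.δ ≫ k.hom
  coassoc X := by
    have h1 := k.comul_left X
    have h2 := k.comul_right X
    have h3 := k.yang_baxter X
    have h4 := G.coassoc X
    simp only [Functor.map_comp, Category.assoc, NatTrans.comp_app, Functor.comp_obj] at *
    rw [reassoc_of% h1, reassoc_of% h2, ← h3, reassoc_of% h4]
  left_counit X := by
    simp [k.counit_right X]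
  right_counit X := by
    simp [k.counit_left X]

/-- The BD-law as a distributive law `G G^κ ⟶ G^κ G`. -/
def oppLaw : CodistribLaw G k.opp where
  hom := k.hom
  counit_right := k.counit_right
  counit_left := k.counit_left
  comul_left := k.comul_left
  comul_right X := by
    have h1 := k.comul_right X
    have h2 := k.yang_baxter X
    simp only [opp, Functor.map_comp, Category.assoc, NatTrans.comp_app] at *
    rw [reassoc_of% h1, h2]

/-- The comonad `G G^κ`. -/
def double : Comonad C := k.oppLaw.comp

/-- The comparison functor from `C` to the category of `G G^κ`-comodules. -/
def comparison : C ⥤ k.double.Coalgebra where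
  obj X :=
    { A := G.obj X
      a := G.δ.app X ≫ G.map (G.δ.app X) ≫ G.map (k.hom.app X)
      counit := by
        have h1 := G.counit_naturality _ (G.δ.app X ≫ k.hom.app X)
        have h2 := k.counit_right X
        simp only [double, CodistribLaw.comp, opp, Functor.map_comp, Category.assoc,
          Functor.id_obj, Functor.comp_obj] at *
        rw [reassoc_of% h1, h2, G.left_counit_assoc, G.right_counit]
      coassoc := by
        have h1 := congrArg G.map (k.opp.coassoc X)
        have h2 := G.delta_naturality _ (G.map (G.δ.app X ≫ k.hom.app X))
        have h3 := G.delta_naturality _ (G.δ.app X ≫ k.hom.app X)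
        have h4 := congrArg G.map (k.comul_left X)
        have h5 := congrArg G.map (k.nat (G.δ.app X ≫ k.hom.app X))
        have h6 := congrArg G.map (G.coassoc X)
        have h7 := G.coassoc X
        simp only [double, CodistribLaw.comp, opp, oppLaw, Functor.map_comp, Category.assoc,
          Functor.comp_map, NatTrans.comp_app, Functor.comp_obj] at *
        rw [← reassoc_of% h1, reassoc_of% h2, reassoc_of% h3, h5, ← reassoc_of% h7,
          reassoc_of% h6, ← reassoc_of% h4] }
  map f :=
    { f := G.map f
      h := by
        have h1 := congrArg G.map (k.nat f)
        have h2 := congrArg G.map (G.delta_naturality _ f)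
        have h3 := G.delta_naturality _ f
        simp only [double, CodistribLaw.comp, opp, Functor.map_comp, Category.assoc,
          Functor.comp_map, Functor.comp_obj] at *
        rw [reassoc_of% h3, reassoc_of% h2, h1] }

/-- `(G, κ)` is an Azumaya comonad. -/
def IsAzumaya : Prop := k.comparison.IsEquivalence

section LeftAdjoint

variable [hk : IsIso k.hom]

instance : IsIso k.oppLaw.hom := hk

variable {L : Monad C} (p : AdjointPair L G)

/-- The mixed distributive law from the left adjoint monad `L` of `G` to `G^κ`, induced by
`κ⁻¹ : G^κ G ⟶ G G^κ`. -/
noncomputable def mixed : MixedDistribLaw L k.opp := k.oppLaw.inv.mate p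

/-- The lifting of the left adjoint monad `L` of `G` to the category of `G^κ`-comodules. -/
noncomputable def liftMonad : Monad k.opp.Coalgebra := (k.mixed p).liftMonad

lemma cofreeAction_aux (w : G.toFunctor ⋙ L.toFunctor ⟶ L.toFunctor ⋙ G.toFunctor)
    (hw : ∀ X : C, p.adj.unit.app (G.obj X) ≫ G.map (w.app X) =
      G.map (p.adj.unit.app X) ≫ (CategoryTheory.inv k.hom).app (L.obj X)) (X : C) :
    (L.map (G.δ.app X ≫ k.hom.app X) ≫ w.app (G.obj X)) ≫
        G.map (L.map (G.δ.app X) ≫ p.adj.counit.app (G.obj X)) =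
      (L.map (G.δ.app X) ≫ p.adj.counit.app (G.obj X)) ≫ G.δ.app X ≫ k.hom.app X := by
  have h1 := hw (G.obj X)
  have h2 : p.adj.unit.app (G.obj X) ≫
      G.map (L.map (G.δ.app X) ≫ p.adj.counit.app (G.obj X)) = G.δ.app X := by
    have h := adj_unit_nat p.adj (G.δ.app X)
    simp only [Functor.map_comp, Functor.comp_obj] at *
    rw [← reassoc_of% h, p.adj.right_triangle_components]
    simp
  have h3 := (CategoryTheory.inv k.hom).naturality
    (L.map (G.δ.app X) ≫ p.adj.counit.app (G.obj X))
  have h4 := adj_unit_nat p.adj (G.δ.app X ≫ k.hom.app X)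
  have h5 := congrArg G.map h2
  have h6 := k.comul_left X
  have h7 : G.δ.app X ≫ k.hom.app X ≫ G.map (G.δ.app X) ≫
      (CategoryTheory.inv k.hom).app (G.obj X) = G.δ.app X ≫ G.map (G.δ.app X) ≫
        G.map (k.hom.app X) := by
    rw [reassoc_of% h6, ← G.coassoc_assoc]
    simp
  generalize L.map (G.δ.app X) ≫ p.adj.counit.app (G.obj X) = β at *
  apply adj_ext' p.adj
  simp only [Functor.map_comp, Category.assoc, Functor.comp_obj, Functor.id_obj,
    Functor.comp_map] at *
  rw [reassoc_of% h2, ← reassoc_of% h4, reassoc_of% h1, ← h3, reassoc_of% h5, h7]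

/-- The module structure, over the lifting of `L`, on the cofree functor of `G^κ`; its
components are `L G A ⟶ L G G A ⟶ G A`. -/
noncomputable def cofreeAction : Action (k.liftMonad p) k.opp.cofree where
  hom :=
    { app := fun X =>
        { f := L.map (G.δ.app X) ≫ p.adj.counit.app (G.obj X)
          h := by
            exact k.cofreeAction_aux p (k.mixed p).hom (k.oppLaw.inv.mate_unit p) X }
      naturality := fun X Y f => by
        ext
        have h1 := congrArg L.map (G.delta_naturality _ f)
        have h2 := adj_counit_nat p.adj (G.map f)
        simp only [Functor.map_comp, Category.assoc] at *
        change L.map (G.map f) ≫ L.map (G.δ.app Y) ≫ p.adj.counit.app (G.obj Y) =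
          (L.map (G.δ.app X) ≫ p.adj.counit.app (G.obj X)) ≫ G.map f
        rw [reassoc_of% h1, h2, Category.assoc] }
  unit X := by
    ext
    change L.η.app (G.obj X) ≫ L.map (G.δ.app X) ≫ p.adj.counit.app (G.obj X) = 𝟙 (G.obj X)
    have h1 := L.unit_naturality _ (G.δ.app X)
    rw [← reassoc_of% h1, ← p.counit_eq, G.left_counit]
  assoc X := by
    ext
    change L.μ.app (G.obj X) ≫ L.map (G.δ.app X) ≫ p.adj.counit.app (G.obj X) =
      L.map (L.map (G.δ.app X) ≫ p.adj.counit.app (G.obj X)) ≫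
        L.map (G.δ.app X) ≫ p.adj.counit.app (G.obj X)
    have h1 := L.mu_naturality _ (G.δ.app X)
    have h2 := p.comul_counit (G.obj X)
    have h3 := congrArg (fun f => L.map (L.map f)) (G.coassoc X)
    have h4 := congrArg L.map (adj_counit_nat p.adj (G.δ.app X))
    simp only [Functor.map_comp, Category.assoc, Functor.comp_obj] at *
    rw [← reassoc_of% h1, ← h2, ← reassoc_of% h3, reassoc_of% h4]

/-- The cofree functor of `G^κ` is Galois with respect to the lifting of `L`. -/
def CofreeIsGalois : Prop := IsIso ((k.cofreeAction p).galoisMap k.opp.adj)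

end LeftAdjoint

end CoBDLaw

/-! ### The comonad BD-law induced by an adjunction -/

namespace BDLaw

variable {F : Monad C} (l : BDLaw F) {R : C ⥤ C} (adj : F.toFunctor ⊣ R)

/-- The comonad BD-law on the right adjoint comonad of `F`: the mate `R R ⟶ R R` of
`λ : F F ⟶ F F`. -/
def mate : CoBDLaw (rightAdjointComonad adj) where
  hom := conjugateEquiv (adj.comp adj) (adj.comp adj) l.hom
  counit_right X := by
    have h1 := mate_hom_counit adj l.hom X
    have h2 := mate_counit_app adj X
    have h3 := mate_counit_app adj (R.obj X)
    generalize conjugateEquiv (adj.comp adj) (adj.comp adj) l.hom = κ at *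
    change κ.app X ≫ (conjugateEquiv adj Adjunction.id F.η).app (R.obj X) =
      R.map ((conjugateEquiv adj Adjunction.id F.η).app X)
    generalize conjugateEquiv adj Adjunction.id F.η = e at *
    apply adj_ext adj
    have h4 := congrArg F.map (F.unit_naturality _ (κ.app X))
    have h5 := l.unit_right (R.obj (R.obj X))
    have h6 := F.unit_naturality _ (adj.counit.app (R.obj X))
    have h7 := adj_counit_nat adj (e.app X)
    simp only [Functor.map_comp, Category.assoc, Functor.comp_obj, Functor.id_obj] at *
    rw [h3, F.map_comp, Category.assoc, reassoc_of% h4, h1, reassoc_of% h5, h7, h2,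
      ← reassoc_of% h6]
  counit_left X := by
    have h1 := mate_hom_counit adj l.hom X
    have h2 := mate_counit_app adj X
    have h3 := mate_counit_app adj (R.obj X)
    generalize conjugateEquiv (adj.comp adj) (adj.comp adj) l.hom = κ at *
    change κ.app X ≫ R.map ((conjugateEquiv adj Adjunction.id F.η).app X) =
      (conjugateEquiv adj Adjunction.id F.η).app (R.obj X)
    generalize conjugateEquiv adj Adjunction.id F.η = e at *
    apply adj_ext adj
    have h4 := F.unit_naturality _ (F.map (κ.app X))
    have h5 := l.unit_left (R.obj (R.obj X))
    have h6 := F.unit_naturality _ (adj.counit.app (R.obj X))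
    have h7 := adj_counit_nat adj (e.app X)
    simp only [Functor.map_comp, Category.assoc, Functor.comp_obj, Functor.id_obj] at *
    rw [h7, h2, reassoc_of% h6, reassoc_of% h4, h1, reassoc_of% h5, h3, F.map_comp,
      Category.assoc]
  comul_right X := by
    have h1 := mate_hom_counit adj l.hom X
    have h2 := congrArg F.map (mate_hom_counit adj l.hom (R.obj X))
    have h3 := mate_comul_counit adj X
    have h4 := congrArg F.map (mate_comul_counit adj (R.obj X))
    generalize conjugateEquiv (adj.comp adj) (adj.comp adj) l.hom = κ at *
    change κ.app X ≫ (conjugateEquiv adj (adj.comp adj) F.μ).app (R.obj X) =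
      R.map ((conjugateEquiv adj (adj.comp adj) F.μ).app X) ≫ κ.app (R.obj X) ≫ R.map (κ.app X)
    generalize conjugateEquiv adj (adj.comp adj) F.μ = d at *
    apply adj_ext_three adj
    have h5 := congrArg F.map (F.mu_naturality _ (κ.app X))
    have h6 := l.mul_right (R.obj (R.obj X))
    have h7 := congrArg (fun f => F.map (F.map f)) (adj_counit_nat adj (κ.app X))
    have h8 := l.nat (F.map (κ.app (R.obj X)))
    have h9 := l.nat (adj.counit.app (R.obj (R.obj X)))
    have h10 := l.nat (F.map (R.map (d.app X)))
    have h11 := congrArg F.map (l.nat (R.map (d.app X)))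
    have h12 := congrArg (fun f => F.map (F.map f)) (adj_counit_nat adj (d.app X))
    have h13 := F.mu_naturality _ (adj.counit.app (R.obj X))
    simp only [Functor.map_comp, Category.assoc, Functor.comp_obj, Functor.id_obj] at *
    rw [reassoc_of% h4, reassoc_of% h5, h1, reassoc_of% h6]
    rw [reassoc_of% h7, h1, reassoc_of% h9, reassoc_of% h8, reassoc_of% h2, reassoc_of% h10,
      reassoc_of% h11, reassoc_of% h12, h3, reassoc_of% h13]
  comul_left X := by
    have h1 := mate_hom_counit adj l.hom X
    have h2 := congrArg F.map (mate_hom_counit adj l.hom (R.obj X))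
    have h3 := mate_comul_counit adj X
    have h4 := congrArg F.map (mate_comul_counit adj (R.obj X))
    generalize conjugateEquiv (adj.comp adj) (adj.comp adj) l.hom = κ at *
    change κ.app X ≫ R.map ((conjugateEquiv adj (adj.comp adj) F.μ).app X) =
      (conjugateEquiv adj (adj.comp adj) F.μ).app (R.obj X) ≫ R.map (κ.app X) ≫ κ.app (R.obj X)
    generalize conjugateEquiv adj (adj.comp adj) F.μ = d at *
    apply adj_ext_three adj
    have h5 := F.mu_naturality _ (F.map (κ.app X))
    have h6 := l.mul_left (R.obj (R.obj X))
    have h7 := congrArg (fun f => F.map (F.map f)) (adj_counit_nat adj (κ.app X))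
    have h8 := congrArg F.map (l.nat (R.map (κ.app X)))
    have h9 := l.nat (adj.counit.app (R.obj (R.obj X)))
    have h10 := congrArg (fun f => F.map (F.map f)) (adj_counit_nat adj (d.app X))
    have h11 := F.mu_naturality _ (adj.counit.app (R.obj X))
    have h12 := congrArg F.map (l.nat (d.app (R.obj X)))
    have h13 := l.nat (F.map (d.app (R.obj X)))
    simp only [Functor.map_comp, Category.assoc, Functor.comp_obj, Functor.id_obj] at *
    rw [reassoc_of% h10, h3, reassoc_of% h11, reassoc_of% h5, h1, reassoc_of% h6]
    rw [reassoc_of% h2, reassoc_of% h8, reassoc_of% h7, h1, reassoc_of% h9, reassoc_of% h12,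
      reassoc_of% h13, reassoc_of% h4]
  yang_baxter X := by
    have h1 := mate_hom_counit adj l.hom X
    have h2 := congrArg F.map (mate_hom_counit adj l.hom (R.obj X))
    generalize conjugateEquiv (adj.comp adj) (adj.comp adj) l.hom = κ at *
    change R.map (κ.app X) ≫ κ.app (R.obj X) ≫ R.map (κ.app X) =
      κ.app (R.obj X) ≫ R.map (κ.app X) ≫ κ.app (R.obj X)
    apply adj_ext_three adj
    have h3 := congrArg (fun f => F.map (F.map f)) (adj_counit_nat adj (κ.app X))
    have h4 := l.nat (adj.counit.app (R.obj (R.obj X)))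
    have h5 := congrArg F.map (l.nat (R.map (κ.app X)))
    have h6 := l.nat (F.map (R.map (κ.app X)))
    have h7 := l.nat (F.map (κ.app (R.obj X)))
    have h8 := congrArg F.map (l.nat (κ.app (R.obj X)))
    have h9 := l.yang_baxter (R.obj (R.obj (R.obj X)))
    simp only [Functor.map_comp, Category.assoc, Functor.comp_obj, Functor.id_obj] at *
    rw [reassoc_of% h3, h1, reassoc_of% h4, reassoc_of% h7, reassoc_of% h6, reassoc_of% h2,
      reassoc_of% h5, reassoc_of% h3, h1, reassoc_of% h4, reassoc_of% h8, reassoc_of% h7,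
      reassoc_of% h2, reassoc_of% h9]

instance [IsIso l.hom] : IsIso (l.mate adj).hom :=
  inferInstanceAs (IsIso (conjugateEquiv (adj.comp adj) (adj.comp adj) l.hom))

end BDLaw
end AzumayaMonad

/-! An `F F^λ`-module is an object `A` with an `F^λ`-action `h` and an `F`-action `r` that are
compatible through `λ`. In the model case `F = B ⊗ -` with `λ` the flip, these are the
`B`-bimodules, and the comparison functor `K` sends `X` to `B ⊗ X`.

Separability: `K` followed by the forgetful functor is `F` itself. A monad is separable exactly when
its forgetful functor is, and the functor `F` is separable exactly when the unit has a natural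
retraction. Hence once `K` is an equivalence, separability of `F F^λ` and splitting of the unit are
the same condition.

Azumaya implies Galois: the Galois map `γ : F A ⟶ R A` at `(A, h)` is the transpose of `h · m`. It
is a bimodule morphism for a natural structure on `R A`, and every bimodule morphism `K X ⟶ R A` has
the form `K s ≫ γ` (`eq_map_comp_galoisHom`). If `K` is an equivalence then `R A ≅ K X` for some
`X`, and this factorization forces `γ` to be invertible. No splitting is needed here.

Galois implies Azumaya: invertibility of `γ` says that `t ↦ F.map t ≫ m ≫ h` is a bijection from
maps `Z ⟶ F A` to maps `F Z ⟶ A` (`pairing_bijective`). For a bimodule `A`, the action `r` is thus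
represented by some `σ : A ⟶ F A`. With `e` a retraction of the unit, `σ ≫ e` is idempotent; its
image `X` is the centralizer of `A`, where the two actions agree, and `F X ≅ A`
(`exists_iso_of_pairing`). Injectivity of the pairing also gives fullness
(`exists_map_eq_of_pairing`), and the split unit gives faithfulness.

The comonad statements are proved by the dual arguments. The two sides meet because transposition
along `F ⊣ R` matches `F^λ`-modules with `R^κ`-comodules on the same object, and the two Galois maps
`F A ⟶ R A` are then the same morphism; likewise the counit is the mate of the unit. -/

lemma CategoryTheory.Monad.adj_counit_app_f {C : Type u} [Category.{v} C] (T : Monad C)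
    (M : T.Algebra) : (T.adj.counit.app M).f = M.a := by
  have : (T.adj.counit.app M).f = T.map (𝟙 M.A) ≫ M.a := rfl
  rw [this, T.map_id]
  exact Category.id_comp _

lemma CategoryTheory.Comonad.adj_unit_app_f {C : Type u} [Category.{v} C] (G : Comonad C)
    (M : G.Coalgebra) : (G.adj.unit.app M).f = M.a := by
  have : (G.adj.unit.app M).f = M.a ≫ G.map (𝟙 M.A) := rfl
  rw [this, G.map_id]
  exact Category.comp_id _

namespace AzumayaMonad

universe w z

/-! ### Separable functors -/

/-- A functor is separable if its action on morphisms has a natural retraction. -/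
def IsSeparableFunctor {C : Type u} [Category.{v} C] {D : Type z} [Category.{w} D]
    (G : D ⥤ C) : Prop :=
  ∃ P : ∀ X Y : D, (G.obj X ⟶ G.obj Y) → (X ⟶ Y),
    (∀ X, P X X (𝟙 _) = 𝟙 X) ∧
    (∀ X Y Z (f : X ⟶ Y) (g : G.obj Y ⟶ G.obj Z), P X Z (G.map f ≫ g) = f ≫ P Y Z g) ∧
    (∀ X Y Z (g : G.obj X ⟶ G.obj Y) (f : Y ⟶ Z), P X Z (g ≫ G.map f) = P X Y g ≫ f)

variable {C : Type u} [Category.{v} C]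

/-- Every object of `D` is isomorphic to some `K X`, so a retraction for `K ⋙ U` is carried to `U`
by conjugating with the chosen isomorphisms; in the other direction full faithfulness of `K` pulls
the retraction back. -/
lemma isSeparableFunctor_comp_iff {B : Type*} [Category* B] {D : Type*} [Category* D]
    (K : B ⥤ D) [K.IsEquivalence] (U : D ⥤ C) :
    IsSeparableFunctor (K ⋙ U) ↔ IsSeparableFunctor U := by
  constructor
  · rintro ⟨P, h1, h2, h3⟩
    have key : ∀ {M N : D} (f : M ⟶ N),
        K.map (K.preimage ((K.objObjPreimageIso M).hom ≫ f ≫ (K.objObjPreimageIso N).inv)) =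
          (K.objObjPreimageIso M).hom ≫ f ≫ (K.objObjPreimageIso N).inv := by
      intros; simp
    refine ⟨fun M N g => (K.objObjPreimageIso M).inv ≫ K.map (P (K.objPreimage M) (K.objPreimage N)
      (U.map (K.objObjPreimageIso M).hom ≫ g ≫ U.map (K.objObjPreimageIso N).inv)) ≫
        (K.objObjPreimageIso N).hom, ?_, ?_, ?_⟩
    · intro M
      have : U.map (K.objObjPreimageIso M).hom ≫ 𝟙 (U.obj M) ≫
          U.map (K.objObjPreimageIso M).inv = 𝟙 ((K ⋙ U).obj _) := by
        rw [Category.id_comp, ← U.map_comp, Iso.hom_inv_id, U.map_id]; rfl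
      dsimp only
      rw [this, h1]
      simp
    · intro M N L f g
      have := h2 _ _ (K.objPreimage L)
        (K.preimage ((K.objObjPreimageIso M).hom ≫ f ≫ (K.objObjPreimageIso N).inv))
        (U.map (K.objObjPreimageIso N).hom ≫ g ≫ U.map (K.objObjPreimageIso L).inv)
      rw [Functor.comp_map, key] at this
      have e : U.map (K.objObjPreimageIso M).hom ≫ (U.map f ≫ g) ≫
          U.map (K.objObjPreimageIso L).inv =
          U.map ((K.objObjPreimageIso M).hom ≫ f ≫ (K.objObjPreimageIso N).inv) ≫
          U.map (K.objObjPreimageIso N).hom ≫ g ≫ U.map (K.objObjPreimageIso L).inv := by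
        simp only [← U.map_comp_assoc, Category.assoc, Iso.inv_hom_id, Category.comp_id]
      dsimp only
      rw [e, this, K.map_comp, key]
      simp
    · intro M N L g f
      have := h3 (K.objPreimage M) _ _
        (U.map (K.objObjPreimageIso M).hom ≫ g ≫ U.map (K.objObjPreimageIso N).inv)
        (K.preimage ((K.objObjPreimageIso N).hom ≫ f ≫ (K.objObjPreimageIso L).inv))
      rw [Functor.comp_map, key] at this
      have e : U.map (K.objObjPreimageIso M).hom ≫ (g ≫ U.map f) ≫
          U.map (K.objObjPreimageIso L).inv =
          (U.map (K.objObjPreimageIso M).hom ≫ g ≫ U.map (K.objObjPreimageIso N).inv) ≫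
          U.map ((K.objObjPreimageIso N).hom ≫ f ≫ (K.objObjPreimageIso L).inv) := by
        simp only [Category.assoc, ← U.map_comp, Iso.inv_hom_id_assoc]
      dsimp only
      rw [e, this, K.map_comp, key]
      simp
  · rintro ⟨P, h1, h2, h3⟩
    refine ⟨fun X Y g => K.preimage (P _ _ g), ?_, ?_, ?_⟩
    · intro X
      apply K.map_injective
      simpa using h1 (K.obj X)
    · intro X Y Z f g
      apply K.map_injective
      simpa using h2 _ _ _ (K.map f) g
    · intro X Y Z g f
      apply K.map_injective
      simpa using h3 _ _ _ g (K.map f)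

/-- A monad is separable if and only if its forgetful functor is. -/
lemma isSeparableMonad_iff_forget (T : Monad C) :
    IsSeparableMonad T ↔ IsSeparableFunctor T.forget := by
  change _ ↔ ∃ P : ∀ M N : T.Algebra, (M.A ⟶ N.A) → (M ⟶ N), (∀ M, P M M (𝟙 M.A) = 𝟙 M) ∧
    (∀ (L M N : T.Algebra) (f : L ⟶ M) (g : M.A ⟶ N.A), P L N (f.f ≫ g) = f ≫ P M N g) ∧
    (∀ (L M N : T.Algebra) (g : L.A ⟶ M.A) (f : M ⟶ N), P L N (g ≫ f.f) = P L M g ≫ f)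
  constructor
  · rintro ⟨ω, h1, h2, h3⟩
    -- `T.η ≫ ω` plays the role of a separability idempotent and `g` is averaged against it: the
    -- inner `T` acts on the source, then `g` is applied, then the outer `T` acts on the target.
    refine ⟨fun M N g =>
      { f := T.η.app M.A ≫ ω.app M.A ≫ T.map M.a ≫ T.map g ≫ N.a
        h := ?_ }, ?_, ?_, ?_⟩
    · have key : T.map (T.η.app M.A) ≫ T.map (ω.app M.A) ≫ T.μ.app (T.obj M.A) = ω.app M.A := by
        have e1 := h3 M.A
        have e2 := T.right_unit M.A
        simp only [Functor.comp_obj, Functor.id_obj] at e1 e2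
        rw [e1, reassoc_of% e2]
      have key2 : M.a ≫ T.η.app M.A ≫ ω.app M.A ≫ T.map M.a = ω.app M.A ≫ T.map M.a := by
        have e1 := T.unit_naturality _ M.a
        have e2 := ω.naturality M.a
        have e3 := h2 M.A
        have e4 := congrArg T.map M.assoc
        have e5 := T.left_unit M.A
        simp only [Functor.map_comp, Functor.comp_map, Functor.comp_obj, Functor.id_obj] at *
        rw [reassoc_of% e1, reassoc_of% e2, ← e4, reassoc_of% e3, reassoc_of% e5]
      have e5 : T.map (T.map g) ≫ T.map N.a ≫ N.a = T.μ.app M.A ≫ T.map g ≫ N.a := by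
        rw [← N.assoc, T.mu_naturality_assoc]
      have e6 := T.mu_naturality _ M.a
      simp only [Functor.map_comp, Category.assoc, Functor.comp_obj] at *
      rw [reassoc_of% key2, e5, reassoc_of% e6, reassoc_of% key]
    · intro M
      ext
      have := h1 M.A
      change T.η.app M.A ≫ ω.app M.A ≫ T.map M.a ≫ T.map (𝟙 M.A) ≫ M.a = 𝟙 M.A
      rw [T.map_id, Category.id_comp, ← M.assoc, reassoc_of% this, M.unit]
    · intro M N L f g
      ext
      change T.η.app M.A ≫ ω.app M.A ≫ T.map M.a ≫ T.map (f.f ≫ g) ≫ L.a =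
        f.f ≫ T.η.app N.A ≫ ω.app N.A ≫ T.map N.a ≫ T.map g ≫ L.a
      have e1 := T.unit_naturality _ f.f
      have e2 := ω.naturality f.f
      have e3 := congrArg T.map f.h
      simp only [Functor.map_comp, Functor.comp_map, Category.assoc] at *
      rw [reassoc_of% e1, reassoc_of% e2, reassoc_of% e3]
    · intro M N L g f
      ext
      change T.η.app M.A ≫ ω.app M.A ≫ T.map M.a ≫ T.map (g ≫ f.f) ≫ L.a =
        (T.η.app M.A ≫ ω.app M.A ≫ T.map M.a ≫ T.map g ≫ N.a) ≫ f.f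
      simp only [Functor.map_comp, Category.assoc, f.h]
  · rintro ⟨P, h1, h2, h3⟩
    -- `Q` is `P` on free modules, with linearity of morphisms spelled out as equations in `C`.
    obtain ⟨Q, q1, q2, q3, q4⟩ : ∃ Q : ∀ X Y : C, (T.obj X ⟶ T.obj Y) → (T.obj X ⟶ T.obj Y),
        (∀ X, Q X X (𝟙 _) = 𝟙 _) ∧
        (∀ X Y g, T.map (Q X Y g) ≫ T.μ.app Y = T.μ.app X ≫ Q X Y g) ∧
        (∀ X Y Z f g, T.map f ≫ T.μ.app Y = T.μ.app X ≫ f → Q X Z (f ≫ g) = f ≫ Q Y Z g) ∧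
        (∀ X Y Z g f, T.map f ≫ T.μ.app Z = T.μ.app Y ≫ f → Q X Z (g ≫ f) = Q X Y g ≫ f) :=
      ⟨fun X Y g => (P (T.free.obj X) (T.free.obj Y) g).f,
        fun X => congrArg Monad.Algebra.Hom.f (h1 (T.free.obj X)),
        fun X Y g => (P (T.free.obj X) (T.free.obj Y) g).h,
        fun X Y Z f g hf => congrArg Monad.Algebra.Hom.f
          (h2 (T.free.obj X) (T.free.obj Y) (T.free.obj Z) ⟨f, hf⟩ g),
        fun X Y Z g f hf => congrArg Monad.Algebra.Hom.f
          (h3 (T.free.obj X) (T.free.obj Y) (T.free.obj Z) g ⟨f, hf⟩)⟩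
    -- The section is the linearization of the non-linear map `T.η : T X ⟶ T T X`. Each law follows
    -- by moving a linear map out of `Q`; for instance `ω ≫ μ = Q (η ≫ μ) = Q (𝟙) = 𝟙`.
    refine ⟨{ app := fun X => Q X (T.obj X) (T.η.app (T.obj X))
              naturality := fun X Y f => ?_ }, fun X => ?_, fun X => ?_, fun X => ?_⟩
    · have e1 := q3 X Y (T.obj Y) (T.map f) (T.η.app (T.obj Y)) (T.mu_naturality _ f)
      have e2 := q4 X (T.obj X) (T.obj Y) (T.η.app (T.obj X)) (T.map (T.map f))
        (T.mu_naturality _ (T.map f))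
      have e3 := T.unit_naturality _ (T.map f)
      exact e1.symm.trans ((congrArg _ e3).trans e2)
    · have e1 := q4 X (T.obj X) X (T.η.app (T.obj X)) (T.μ.app X) (T.assoc X)
      exact e1.symm.trans ((congrArg _ (T.left_unit X)).trans (q1 X))
    · have e1 := q4 (T.obj X) (T.obj (T.obj X)) (T.obj X) (T.η.app (T.obj (T.obj X)))
        (T.map (T.μ.app X)) (T.mu_naturality _ (T.μ.app X))
      have e2 := q3 (T.obj X) X (T.obj X) (T.μ.app X) (T.η.app (T.obj X)) (T.assoc X)
      have e3 := T.unit_naturality _ (T.μ.app X)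
      exact e1.symm.trans ((congrArg _ e3.symm).trans e2)
    · exact q2 X (T.obj X) _

/-- A comonad is separable if and only if its forgetful functor is. -/
lemma isSeparableComonad_iff_forget (G : Comonad C) :
    IsSeparableComonad G ↔ IsSeparableFunctor G.forget := by
  change _ ↔ ∃ P : ∀ M N : G.Coalgebra, (M.A ⟶ N.A) → (M ⟶ N), (∀ M, P M M (𝟙 M.A) = 𝟙 M) ∧
    (∀ (L M N : G.Coalgebra) (f : L ⟶ M) (g : M.A ⟶ N.A), P L N (f.f ≫ g) = f ≫ P M N g) ∧
    (∀ (L M N : G.Coalgebra) (g : L.A ⟶ M.A) (f : M ⟶ N), P L N (g ≫ f.f) = P L M g ≫ f)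
  constructor
  · rintro ⟨ω, h1, h2, h3⟩
    -- Dual averaging: `ω ≫ G.ε` contracts the coaction of the source, pushed through `g`, against
    -- the coaction of the target.
    refine ⟨fun N M g =>
      { f := N.a ≫ G.map g ≫ G.map M.a ≫ ω.app M.A ≫ G.ε.app M.A
        h := ?_ }, ?_, ?_, ?_⟩
    · have key : G.δ.app (G.obj M.A) ≫ G.map (ω.app M.A) ≫ G.map (G.ε.app M.A) = ω.app M.A := by
        have e1 := h3 M.A
        have e2 := G.right_counit M.A
        simp only [Functor.comp_obj, Functor.id_obj] at e1 e2
        rw [reassoc_of% e1, e2, Category.comp_id]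
      have key2 : G.map M.a ≫ ω.app M.A ≫ G.ε.app M.A ≫ M.a = G.map M.a ≫ ω.app M.A := by
        have e1 := G.counit_naturality _ M.a
        have e2 := ω.naturality M.a
        have e3 := h2 M.A
        have e4 := congrArg G.map M.coassoc
        have e5 := G.left_counit M.A
        simp only [Functor.map_comp, Functor.comp_map, Functor.comp_obj, Functor.id_obj] at *
        rw [← e1, ← reassoc_of% e2, ← reassoc_of% e4, reassoc_of% e3, e5, Category.comp_id]
      have e5 : N.a ≫ G.map N.a ≫ G.map (G.map g) = N.a ≫ G.map g ≫ G.δ.app M.A := by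
        rw [← N.coassoc_assoc, G.delta_naturality]
      have e6 := G.delta_naturality _ M.a
      simp only [Functor.map_comp, Category.assoc, Functor.comp_obj] at *
      rw [key2, reassoc_of% e5, ← reassoc_of% e6, key]
    · intro M
      ext
      have := h1 M.A
      change M.a ≫ G.map (𝟙 M.A) ≫ G.map M.a ≫ ω.app M.A ≫ G.ε.app M.A = 𝟙 M.A
      rw [G.map_id, Category.id_comp, ← M.coassoc_assoc, reassoc_of% this, M.counit]
    · intro M N L f g
      ext
      change M.a ≫ G.map (f.f ≫ g) ≫ G.map L.a ≫ ω.app L.A ≫ G.ε.app L.A =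
        f.f ≫ N.a ≫ G.map g ≫ G.map L.a ≫ ω.app L.A ≫ G.ε.app L.A
      rw [← f.h_assoc, G.map_comp_assoc]
    · intro M N L g f
      ext
      change M.a ≫ G.map (g ≫ f.f) ≫ G.map L.a ≫ ω.app L.A ≫ G.ε.app L.A =
        (M.a ≫ G.map g ≫ G.map N.a ≫ ω.app N.A ≫ G.ε.app N.A) ≫ f.f
      have e1 := G.counit_naturality _ f.f
      have e2 := ω.naturality f.f
      have e3 := congrArg G.map f.h
      simp only [Functor.map_comp, Functor.comp_map, Category.assoc] at *
      rw [← e1, ← reassoc_of% e2, reassoc_of% e3]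
  · rintro ⟨P, h1, h2, h3⟩
    obtain ⟨Q, q1, q2, q3, q4⟩ : ∃ Q : ∀ X Y : C, (G.obj X ⟶ G.obj Y) → (G.obj X ⟶ G.obj Y),
        (∀ X, Q X X (𝟙 _) = 𝟙 _) ∧
        (∀ X Y g, G.δ.app X ≫ G.map (Q X Y g) = Q X Y g ≫ G.δ.app Y) ∧
        (∀ X Y Z f g, G.δ.app X ≫ G.map f = f ≫ G.δ.app Y → Q X Z (f ≫ g) = f ≫ Q Y Z g) ∧
        (∀ X Y Z g f, G.δ.app Y ≫ G.map f = f ≫ G.δ.app Z → Q X Z (g ≫ f) = Q X Y g ≫ f) :=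
      ⟨fun X Y g => (P (G.cofree.obj X) (G.cofree.obj Y) g).f,
        fun X => congrArg Comonad.Coalgebra.Hom.f (h1 (G.cofree.obj X)),
        fun X Y g => (P (G.cofree.obj X) (G.cofree.obj Y) g).h,
        fun X Y Z f g hf => congrArg Comonad.Coalgebra.Hom.f
          (h2 (G.cofree.obj X) (G.cofree.obj Y) (G.cofree.obj Z) ⟨f, hf⟩ g),
        fun X Y Z g f hf => congrArg Comonad.Coalgebra.Hom.f
          (h3 (G.cofree.obj X) (G.cofree.obj Y) (G.cofree.obj Z) g ⟨f, hf⟩)⟩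
    -- The retraction is the colinearization of the counit `G G X ⟶ G X`.
    refine ⟨{ app := fun X => Q (G.obj X) X (G.ε.app (G.obj X))
              naturality := fun X Y f => ?_ }, fun X => ?_, fun X => ?_, fun X => ?_⟩
    · have e1 := q3 (G.obj X) (G.obj Y) Y (G.map (G.map f)) (G.ε.app (G.obj Y))
        (G.delta_naturality _ (G.map f)).symm
      have e2 := q4 (G.obj X) X Y (G.ε.app (G.obj X)) (G.map f) (G.delta_naturality _ f).symm
      have e3 := G.counit_naturality _ (G.map f)
      exact e1.symm.trans ((congrArg _ e3).trans e2)
    · have e1 := q3 X (G.obj X) X (G.δ.app X) (G.ε.app (G.obj X)) (G.coassoc X)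
      exact e1.symm.trans ((congrArg _ (G.left_counit X)).trans (q1 X))
    · have e1 := q3 (G.obj X) (G.obj (G.obj X)) (G.obj X) (G.map (G.δ.app X))
        (G.ε.app (G.obj (G.obj X))) (G.delta_naturality _ (G.δ.app X)).symm
      have e2 := q4 (G.obj X) X (G.obj X) (G.ε.app (G.obj X)) (G.δ.app X) (G.coassoc X)
      have e3 := G.counit_naturality _ (G.δ.app X)
      exact e1.symm.trans ((congrArg _ e3).trans e2)
    · exact q2 (G.obj X) X _

/-! ### Split units and split counits -/

/-- The functor part of a monad is separable if and only if the unit is a split monomorphism. -/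
lemma isSeparableFunctor_iff_isSplitMono (F : Monad C) :
    IsSeparableFunctor F.toFunctor ↔ IsSplitMono F.η := by
  constructor
  · rintro ⟨P, h1, h2, h3⟩
    -- The multiplication is a map from `F (F X)` to `F X`, so `P` turns it into a map `F X ⟶ X`;
    -- the unit law `F η ≫ μ = 𝟙` makes this a retraction of the unit.
    refine ⟨⟨⟨{ app := fun X => P (F.obj X) X (F.μ.app X), naturality := ?_ }, ?_⟩⟩⟩
    · intro X Y f
      change F.map f ≫ _ = _ ≫ f
      rw [← h2, ← h3]
      congr 1
      exact F.mu_naturality _ f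
    · ext X
      change F.η.app X ≫ P (F.obj X) X (F.μ.app X) = 𝟙 X
      rw [← h2, ← h1]
      congr 1
      exact F.right_unit X
  · rintro ⟨⟨e, he⟩⟩
    refine ⟨fun X Y g => F.η.app X ≫ g ≫ e.app Y, fun X => ?_, fun X Y Z f g => ?_,
      fun X Y Z g f => ?_⟩
    · simpa using NatTrans.congr_app he X
    · have := F.unit_naturality _ f
      simp [← reassoc_of% this]
    · have := e.naturality f
      dsimp at this
      simp [this]

/-- The functor part of a comonad is separable if and only if the counit is a split
epimorphism. -/
lemma isSeparableFunctor_iff_isSplitEpi (G : Comonad C) :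
    IsSeparableFunctor G.toFunctor ↔ IsSplitEpi G.ε := by
  constructor
  · rintro ⟨P, h1, h2, h3⟩
    refine ⟨⟨⟨{ app := fun X => P X (G.obj X) (G.δ.app X), naturality := ?_ }, ?_⟩⟩⟩
    · intro X Y f
      change f ≫ _ = _ ≫ G.map f
      rw [← h2, ← h3]
      congr 1
      exact G.delta_naturality _ f
    · ext X
      change P X (G.obj X) (G.δ.app X) ≫ G.ε.app X = 𝟙 X
      rw [← h3, ← h1]
      congr 1
      exact G.right_counit X
  · rintro ⟨⟨e, he⟩⟩
    refine ⟨fun X Y g => e.app X ≫ g ≫ G.ε.app Y, fun X => ?_, fun X Y Z f g => ?_,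
      fun X Y Z g f => ?_⟩
    · simpa using NatTrans.congr_app he X
    · have := e.naturality f
      dsimp at this
      simp [← reassoc_of% this]
    · have := G.counit_naturality _ f
      simp [this]

/-- The comparison functor followed by the forgetful functor is `F` by definition, so separability
passes from the forgetful functor to `F` across the equivalence. -/
lemma BDLaw.IsAzumaya.isSeparableMonad_iff {F : Monad C} {l : BDLaw F} (h : l.IsAzumaya) :
    IsSeparableMonad l.double ↔ IsSplitMono F.η := by
  have : l.comparison.IsEquivalence := h
  rw [isSeparableMonad_iff_forget, ← isSeparableFunctor_comp_iff l.comparison,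
    ← isSeparableFunctor_iff_isSplitMono]
  rfl

lemma CoBDLaw.IsAzumaya.isSeparableComonad_iff {G : Comonad C} {k : CoBDLaw G}
    (h : k.IsAzumaya) : IsSeparableComonad k.double ↔ IsSplitEpi G.ε := by
  have : k.comparison.IsEquivalence := h
  rw [isSeparableComonad_iff_forget, ← isSeparableFunctor_comp_iff k.comparison,
    ← isSeparableFunctor_iff_isSplitEpi]
  rfl

/-- For a monad `F` with right adjoint comonad, the unit is a split monomorphism if and only if
the counit is a split epimorphism. -/
lemma AdjointPair.isSplitMono_iff_isSplitEpi {F : Monad C} {G : Comonad C} (p : AdjointPair F G) :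
    IsSplitMono F.η ↔ IsSplitEpi G.ε := by
  rw [p.counit_mate]
  constructor
  · rintro ⟨⟨e, he⟩⟩
    -- Taking mates reverses composition, so the mate of a retraction of the unit is a section of
    -- the counit.
    refine ⟨⟨⟨conjugateEquiv Adjunction.id p.adj e, ?_⟩⟩⟩
    rw [conjugateEquiv_comp, he, conjugateEquiv_id]
  · rintro ⟨⟨e, he⟩⟩
    refine ⟨⟨⟨(conjugateEquiv Adjunction.id p.adj).symm e, ?_⟩⟩⟩
    apply (conjugateEquiv Adjunction.id Adjunction.id).injective
    rw [← conjugateEquiv_comp _ p.adj, Equiv.apply_symm_apply, he, conjugateEquiv_id]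

/-! ### Modules over composite monads -/

namespace DistribLaw

variable {T S : Monad C} (l : DistribLaw T S)

/-- A pair of compatible actions of `T` and `S` is a module over the composite monad. -/
def algebraOfPair (A : C) (h : T.obj A ⟶ A) (r : S.obj A ⟶ A)
    (h_unit : T.η.app A ≫ h = 𝟙 A) (h_assoc : T.μ.app A ≫ h = T.map h ≫ h)
    (r_unit : S.η.app A ≫ r = 𝟙 A) (r_assoc : S.μ.app A ≫ r = S.map r ≫ r)
    (compat : T.map r ≫ h = l.hom.app A ≫ S.map h ≫ r) : l.comp.Algebra where
  A := A
  a := S.map h ≫ r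
  unit := by
    have h1 := S.unit_naturality _ h
    simp only [comp, Category.assoc, Functor.comp_obj, Functor.id_obj] at *
    rw [← reassoc_of% h1, reassoc_of% h_unit, r_unit]
  assoc := by
    have h1 := S.mu_naturality _ h
    have h2 := congrArg S.map h_assoc
    have h3 := congrArg S.map compat
    have h4 := congrArg S.map (l.nat h)
    have h5 := S.mu_naturality _ (T.map h)
    simp only [comp, Functor.map_comp, Category.assoc, Functor.comp_obj, Functor.comp_map] at *
    rw [reassoc_of% h2, reassoc_of% h3, reassoc_of% h4, ← r_assoc, reassoc_of% h1,
      reassoc_of% h5]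

section

variable (M : l.comp.Algebra)

/-- The action of the composite monad on a module. -/
def action : S.obj (T.obj M.A) ⟶ M.A := M.a

/-- The `T`-action underlying a module over the composite monad. -/
def fstAction : T.obj M.A ⟶ M.A := S.η.app (T.obj M.A) ≫ l.action M

/-- The `S`-action underlying a module over the composite monad. -/
def sndAction : S.obj M.A ⟶ M.A := S.map (T.η.app M.A) ≫ l.action M

/-- Module associativity with the composite multiplication unfolded into `T`, `S` and the law, the
form in which the rewrites below can use it. -/
lemma algebra_assoc :
    S.map (T.map (l.action M)) ≫ l.action M = S.map (l.hom.app (T.obj M.A)) ≫ S.μ.app (T.obj (T.obj M.A)) ≫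
      S.map (T.μ.app M.A) ≫ l.action M := by
  have : (S.map (l.hom.app (T.obj M.A)) ≫ S.μ.app (T.obj (T.obj M.A)) ≫ S.map (T.μ.app M.A)) ≫
      l.action M = S.map (T.map (l.action M)) ≫ l.action M := M.assoc
  simpa only [Category.assoc] using this.symm

lemma fstAction_unit : T.η.app M.A ≫ l.fstAction M = 𝟙 M.A := by
  have : (T.η.app M.A ≫ S.η.app (T.obj M.A)) ≫ l.action M = 𝟙 M.A := M.unit
  exact (Category.assoc _ _ _).symm.trans this

lemma sndAction_unit : S.η.app M.A ≫ l.sndAction M = 𝟙 M.A := by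
  have h1 := l.fstAction_unit M
  have h2 := S.unit_naturality _ (T.η.app M.A)
  simp only [fstAction, sndAction, Functor.id_obj] at *
  rw [reassoc_of% h2.symm, h1]

/-- Obtained from `algebra_assoc` by filling the outermost `S` with its unit. The free map `f` is
specialized twice: `T.map S.η` gives associativity of the `T`-action, and `T.map (S.map T.η)` gives
compatibility of the two actions. -/
lemma map_comp_fstAction {X : C} (f : T.obj X ⟶ T.obj (S.obj (T.obj M.A))) :
    f ≫ T.map (l.action M) ≫ l.fstAction M =
      f ≫ l.hom.app (T.obj M.A) ≫ S.map (T.μ.app M.A) ≫ l.action M := by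
  have h1 := S.unit_naturality _ (T.map (l.action M))
  have h2 := l.algebra_assoc M
  have h3 := S.unit_naturality _ (l.hom.app (T.obj M.A))
  have h4 := S.left_unit (T.obj (T.obj M.A))
  simp only [fstAction, Functor.comp_obj, Functor.id_obj] at *
  rw [reassoc_of% h1, h2, ← reassoc_of% h3, reassoc_of% h4]

lemma fstAction_assoc : T.μ.app M.A ≫ l.fstAction M = T.map (l.fstAction M) ≫ l.fstAction M := by
  have h1 := l.map_comp_fstAction M (T.map (S.η.app (T.obj M.A)))
  have h2 := l.unit_right (T.obj M.A)
  have h3 := S.unit_naturality _ (T.μ.app M.A)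
  have h4 : T.map (l.fstAction M) = T.map (S.η.app (T.obj M.A)) ≫ T.map (l.action M) := T.map_comp _ _
  rw [h4, Category.assoc, h1, reassoc_of% h2]
  simp only [fstAction, Functor.comp_obj, Functor.id_obj] at *
  rw [reassoc_of% h3]

lemma sndAction_assoc : S.μ.app M.A ≫ l.sndAction M = S.map (l.sndAction M) ≫ l.sndAction M := by
  have h1 := congrArg S.map (T.unit_naturality _ (l.action M))
  have h2 := l.algebra_assoc M
  have h3 := congrArg S.map (l.unit_left (T.obj M.A))
  have h4 := S.mu_naturality _ (T.η.app (T.obj M.A))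
  have h5 : S.map (T.η.app (T.obj M.A)) ≫ S.map (T.μ.app M.A) = 𝟙 (S.obj (T.obj M.A)) :=
    (S.map_comp _ _).symm.trans ((congrArg S.map (T.left_unit M.A)).trans (S.map_id _))
  have h6 := S.mu_naturality _ (T.η.app M.A)
  simp only [comp, sndAction, Functor.map_comp, Category.assoc, Functor.comp_obj, Functor.id_obj] at *
  rw [reassoc_of% h1, h2, reassoc_of% h3, reassoc_of% h4, reassoc_of% h5, reassoc_of% h6]

/-- Together with `action_eq` this is the hypothesis `compat` of `algebraOfPair`. -/
lemma action_compat :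
    T.map (l.sndAction M) ≫ l.fstAction M = l.hom.app M.A ≫ l.action M := by
  have h1 := l.map_comp_fstAction M (T.map (S.map (T.η.app M.A)))
  have h2 := l.nat (T.η.app M.A)
  have h3 : S.map (T.map (T.η.app M.A)) ≫ S.map (T.μ.app M.A) = 𝟙 (S.obj (T.obj M.A)) :=
    (S.map_comp _ _).symm.trans ((congrArg S.map (T.right_unit M.A)).trans (S.map_id _))
  have h4 : T.map (l.sndAction M) = T.map (S.map (T.η.app M.A)) ≫ T.map (l.action M) := T.map_comp _ _
  rw [h4, Category.assoc, h1]
  simp only [Functor.comp_obj, Functor.id_obj] at *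
  rw [reassoc_of% h2, reassoc_of% h3]

/-- Since the composite action is recovered from its two parts, linearity of a morphism can be
tested on each part separately. -/
lemma action_eq : S.map (l.fstAction M) ≫ l.sndAction M = l.action M := by
  have h1 := congrArg S.map (T.unit_naturality _ (l.action M))
  have h2 := l.algebra_assoc M
  have h3 := congrArg S.map (l.unit_left (T.obj M.A))
  have h4 := S.mu_naturality _ (T.η.app (T.obj M.A))
  have h5 : S.map (T.η.app (T.obj M.A)) ≫ S.map (T.μ.app M.A) = 𝟙 (S.obj (T.obj M.A)) :=
    (S.map_comp _ _).symm.trans ((congrArg S.map (T.left_unit M.A)).trans (S.map_id _))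
  have h6 := S.right_unit (T.obj M.A)
  simp only [comp, fstAction, sndAction, Functor.map_comp, Category.assoc, Functor.comp_obj,
    Functor.id_obj] at *
  rw [reassoc_of% h1, h2, reassoc_of% h3, reassoc_of% h4, reassoc_of% h5, reassoc_of% h6]

end

variable {l}

lemma hom_fstAction {M N : l.comp.Algebra} (g : M ⟶ N) :
    T.map g.f ≫ l.fstAction N = l.fstAction M ≫ g.f := by
  have h1 : S.map (T.map g.f) ≫ l.action N = l.action M ≫ g.f := g.h
  have h2 := S.unit_naturality _ (T.map g.f)
  simp only [fstAction, Category.assoc, Functor.id_obj] at *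
  rw [reassoc_of% h2, h1]

lemma hom_sndAction {M N : l.comp.Algebra} (g : M ⟶ N) :
    S.map g.f ≫ l.sndAction N = l.sndAction M ≫ g.f := by
  have h1 : S.map (T.map g.f) ≫ l.action N = l.action M ≫ g.f := g.h
  have h2 := congrArg S.map (T.unit_naturality _ g.f)
  simp only [sndAction, Category.assoc, Functor.id_obj, Functor.map_comp] at *
  rw [reassoc_of% h2, h1]

/-- A morphism compatible with both actions is a morphism of modules over the composite monad. -/
def homOfPair {M N : l.comp.Algebra} (g : M.A ⟶ N.A)
    (h1 : T.map g ≫ l.fstAction N = l.fstAction M ≫ g)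
    (h2 : S.map g ≫ l.sndAction N = l.sndAction M ≫ g) : M ⟶ N where
  f := g
  h := by
    have h3 := congrArg S.map h1
    change S.map (T.map g) ≫ l.action N = l.action M ≫ g
    rw [← l.action_eq M, ← l.action_eq N]
    simp only [Functor.map_comp, Category.assoc] at *
    rw [reassoc_of% h3, h2]

section

variable (l) (A : C) (h : T.obj A ⟶ A) (r : S.obj A ⟶ A)
    (h_unit : T.η.app A ≫ h = 𝟙 A) (h_assoc : T.μ.app A ≫ h = T.map h ≫ h)
    (r_unit : S.η.app A ≫ r = 𝟙 A) (r_assoc : S.μ.app A ≫ r = S.map r ≫ r)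
    (compat : T.map r ≫ h = l.hom.app A ≫ S.map h ≫ r)

lemma fstAction_algebraOfPair :
    l.fstAction (l.algebraOfPair A h r h_unit h_assoc r_unit r_assoc compat) = h := by
  have h1 := S.unit_naturality _ h
  change S.η.app (T.obj A) ≫ S.map h ≫ r = h
  simp only [Functor.id_obj] at *
  rw [← reassoc_of% h1, r_unit, Category.comp_id]

lemma sndAction_algebraOfPair :
    l.sndAction (l.algebraOfPair A h r h_unit h_assoc r_unit r_assoc compat) = r := by
  change S.map (T.η.app A) ≫ S.map h ≫ r = r
  rw [← S.map_comp_assoc, h_unit]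
  exact (congrArg (· ≫ r) (S.map_id A)).trans (Category.id_comp r)

end

end DistribLaw

/-! ### Comodules over composite comonads -/

namespace CodistribLaw

variable {H G : Comonad C} (k : CodistribLaw H G)

/-- A pair of compatible coactions of `H` and `G` is a comodule over the composite comonad. -/
def coalgebraOfPair (A : C) (h : A ⟶ H.obj A) (r : A ⟶ G.obj A)
    (h_counit : h ≫ H.ε.app A = 𝟙 A) (h_coassoc : h ≫ H.δ.app A = h ≫ H.map h)
    (r_counit : r ≫ G.ε.app A = 𝟙 A) (r_coassoc : r ≫ G.δ.app A = r ≫ G.map r)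
    (compat : r ≫ G.map h = h ≫ H.map r ≫ k.hom.app A) : k.comp.Coalgebra where
  A := A
  a := h ≫ H.map r
  counit := by
    have h1 := H.counit_naturality _ r
    simp only [comp, Category.assoc, Functor.comp_obj, Functor.id_obj] at *
    rw [reassoc_of% h1, reassoc_of% h_counit, r_counit]
  coassoc := by
    have h1 := H.delta_naturality _ r
    have h2 := congrArg H.map r_coassoc
    have h3 := congrArg H.map compat
    have h4 := congrArg H.map (k.nat r)
    have h5 := H.delta_naturality _ (G.map r)
    simp only [comp, Functor.map_comp, Category.assoc, Functor.comp_obj, Functor.comp_map] at *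
    rw [reassoc_of% h2, reassoc_of% h5, reassoc_of% h1, reassoc_of% h_coassoc, reassoc_of% h3, h4]

section

variable (M : k.comp.Coalgebra)

/-- The coaction of the composite comonad on a comodule. -/
def coaction : M.A ⟶ H.obj (G.obj M.A) := M.a

/-- The `G`-coaction underlying a comodule over the composite comonad. -/
def fstCoaction : M.A ⟶ G.obj M.A := k.coaction M ≫ H.ε.app (G.obj M.A)

/-- The `H`-coaction underlying a comodule over the composite comonad. -/
def sndCoaction : M.A ⟶ H.obj M.A := k.coaction M ≫ H.map (G.ε.app M.A)

lemma coalgebra_coassoc :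
    k.coaction M ≫ H.map (G.map (k.coaction M)) = k.coaction M ≫ H.map (G.δ.app M.A) ≫ H.δ.app (G.obj (G.obj M.A)) ≫
      H.map (k.hom.app (G.obj M.A)) := by
  exact M.coassoc.symm

lemma fstCoaction_counit : k.fstCoaction M ≫ G.ε.app M.A = 𝟙 M.A := by
  have : k.coaction M ≫ H.ε.app (G.obj M.A) ≫ G.ε.app M.A = 𝟙 M.A := M.counit
  simpa only [fstCoaction, Category.assoc] using this

lemma sndCoaction_counit : k.sndCoaction M ≫ H.ε.app M.A = 𝟙 M.A := by
  have h1 := k.fstCoaction_counit M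
  have h2 := H.counit_naturality _ (G.ε.app M.A)
  simp only [fstCoaction, sndCoaction, Functor.id_obj, Category.assoc] at *
  rw [h2, h1]

/-- Coassociativity with the outermost `H` removed by its counit; both coassociativity of the
`G`-coaction and compatibility of the two coactions are read off from it. -/
lemma fstCoaction_comp_map :
    k.fstCoaction M ≫ G.map (k.coaction M) =
      k.coaction M ≫ H.map (G.δ.app M.A) ≫ k.hom.app (G.obj M.A) := by
  have h1 := H.counit_naturality _ (G.map (k.coaction M))
  have h2 := k.coalgebra_coassoc M
  have h3 := H.counit_naturality _ (k.hom.app (G.obj M.A))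
  have h4 := H.left_counit (G.obj (G.obj M.A))
  simp only [fstCoaction, Functor.comp_obj, Functor.id_obj, Category.assoc] at *
  rw [← h1, reassoc_of% h2, h3, reassoc_of% h4]

lemma fstCoaction_coassoc :
    k.fstCoaction M ≫ G.δ.app M.A = k.fstCoaction M ≫ G.map (k.fstCoaction M) := by
  have h1 := k.fstCoaction_comp_map M
  have h2 := k.counit_left (G.obj M.A)
  have h3 := H.counit_naturality _ (G.δ.app M.A)
  have h4 : G.map (k.fstCoaction M) = G.map (k.coaction M) ≫ G.map (H.ε.app (G.obj M.A)) := G.map_comp _ _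
  rw [h4, reassoc_of% h1, h2]
  simp only [fstCoaction, Functor.comp_obj, Functor.id_obj, Category.assoc] at *
  rw [h3]

lemma sndCoaction_coassoc :
    k.sndCoaction M ≫ H.δ.app M.A = k.sndCoaction M ≫ H.map (k.sndCoaction M) := by
  have h1 := congrArg H.map (G.counit_naturality _ (k.coaction M))
  have h2 := k.coalgebra_coassoc M
  have h3 := congrArg H.map (k.counit_right (G.obj M.A))
  have h4 := H.delta_naturality _ (G.ε.app (G.obj M.A))
  have h5 : H.map (G.δ.app M.A) ≫ H.map (G.ε.app (G.obj M.A)) = 𝟙 (H.obj (G.obj M.A)) :=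
    (H.map_comp _ _).symm.trans ((congrArg H.map (G.left_counit M.A)).trans (H.map_id _))
  have h6 := H.delta_naturality _ (G.ε.app M.A)
  simp only [sndCoaction, Functor.map_comp, Category.assoc, Functor.comp_obj,
    Functor.id_obj] at *
  rw [← reassoc_of% h1, reassoc_of% h2, reassoc_of% h3, ← reassoc_of% h4, reassoc_of% h5, ← h6]

lemma coaction_compat :
    k.fstCoaction M ≫ G.map (k.sndCoaction M) = k.coaction M ≫ k.hom.app M.A := by
  have h1 := k.fstCoaction_comp_map M
  have h2 := k.nat (G.ε.app M.A)
  have h3 : H.map (G.δ.app M.A) ≫ H.map (G.map (G.ε.app M.A)) = 𝟙 (H.obj (G.obj M.A)) :=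
    (H.map_comp _ _).symm.trans ((congrArg H.map (G.right_counit M.A)).trans (H.map_id _))
  have h4 : G.map (k.sndCoaction M) = G.map (k.coaction M) ≫ G.map (H.map (G.ε.app M.A)) := G.map_comp _ _
  rw [h4, reassoc_of% h1]
  simp only [Functor.comp_obj, Functor.id_obj] at *
  rw [← h2, reassoc_of% h3]

lemma coaction_eq : k.sndCoaction M ≫ H.map (k.fstCoaction M) = k.coaction M := by
  have h1 := congrArg H.map (G.counit_naturality _ (k.coaction M))
  have h2 := k.coalgebra_coassoc M
  have h3 := congrArg H.map (k.counit_right (G.obj M.A))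
  have h4 := H.delta_naturality _ (G.ε.app (G.obj M.A))
  have h5 : H.map (G.δ.app M.A) ≫ H.map (G.ε.app (G.obj M.A)) = 𝟙 (H.obj (G.obj M.A)) :=
    (H.map_comp _ _).symm.trans ((congrArg H.map (G.left_counit M.A)).trans (H.map_id _))
  have h6 := H.right_counit (G.obj M.A)
  simp only [fstCoaction, sndCoaction, Functor.map_comp, Category.assoc, Functor.comp_obj,
    Functor.id_obj] at *
  rw [← reassoc_of% h1, reassoc_of% h2, reassoc_of% h3, ← reassoc_of% h4, reassoc_of% h5, h6,
    Category.comp_id]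

end

variable {k}

lemma hom_fstCoaction {M N : k.comp.Coalgebra} (g : M ⟶ N) :
    k.fstCoaction M ≫ G.map g.f = g.f ≫ k.fstCoaction N := by
  have h1 : k.coaction M ≫ H.map (G.map g.f) = g.f ≫ k.coaction N := g.h
  have h2 := H.counit_naturality _ (G.map g.f)
  simp only [fstCoaction, Category.assoc, Functor.id_obj] at *
  rw [← h2, reassoc_of% h1]

lemma hom_sndCoaction {M N : k.comp.Coalgebra} (g : M ⟶ N) :
    k.sndCoaction M ≫ H.map g.f = g.f ≫ k.sndCoaction N := by
  have h1 : k.coaction M ≫ H.map (G.map g.f) = g.f ≫ k.coaction N := g.h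
  have h2 := congrArg H.map (G.counit_naturality _ g.f)
  simp only [sndCoaction, Category.assoc, Functor.id_obj, Functor.map_comp] at *
  rw [← h2, reassoc_of% h1]

/-- A morphism compatible with both coactions is a morphism of comodules over the composite
comonad. -/
def homOfPair {M N : k.comp.Coalgebra} (g : M.A ⟶ N.A)
    (h1 : k.fstCoaction M ≫ G.map g = g ≫ k.fstCoaction N)
    (h2 : k.sndCoaction M ≫ H.map g = g ≫ k.sndCoaction N) : M ⟶ N where
  f := g
  h := by
    have h3 := congrArg H.map h1
    change k.coaction M ≫ H.map (G.map g) = g ≫ k.coaction N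
    rw [← k.coaction_eq M, ← k.coaction_eq N]
    simp only [Functor.map_comp, Category.assoc] at *
    rw [h3, reassoc_of% h2]

section

variable (k) (A : C) (h : A ⟶ H.obj A) (r : A ⟶ G.obj A)
    (h_counit : h ≫ H.ε.app A = 𝟙 A) (h_coassoc : h ≫ H.δ.app A = h ≫ H.map h)
    (r_counit : r ≫ G.ε.app A = 𝟙 A) (r_coassoc : r ≫ G.δ.app A = r ≫ G.map r)
    (compat : r ≫ G.map h = h ≫ H.map r ≫ k.hom.app A)

lemma fstCoaction_coalgebraOfPair :
    k.fstCoaction (k.coalgebraOfPair A h r h_counit h_coassoc r_counit r_coassoc compat) = r := by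
  have h1 := H.counit_naturality _ r
  change (h ≫ H.map r) ≫ H.ε.app (G.obj A) = r
  simp only [Functor.id_obj, Category.assoc] at *
  rw [h1, reassoc_of% h_counit]

lemma sndCoaction_coalgebraOfPair :
    k.sndCoaction (k.coalgebraOfPair A h r h_counit h_coassoc r_counit r_coassoc compat) = h := by
  change (h ≫ H.map r) ≫ H.map (G.ε.app A) = h
  rw [Category.assoc, ← H.map_comp, r_counit]
  exact (congrArg (h ≫ ·) (H.map_id A)).trans (Category.comp_id h)

end

end CodistribLaw

/-! ### Azumaya monads and Galois free functors -/

namespace BDLaw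

variable {F : Monad C} (l : BDLaw F)

/-- The pairing `F A ⊗ F A ⟶ A` of a module `(A, h)` over the opposite monad, viewed as a map on
generalized elements of `F A`. -/
def pairing {A : C} (h : F.obj A ⟶ A) (X : C) (t : X ⟶ F.obj A) : F.obj X ⟶ A :=
  F.map t ≫ F.μ.app A ≫ h

/-- With the next lemma, this identifies the comparison object as the regular bimodule: `F^λ` acts
by `m · λ` and `F` by `m`. -/
lemma fstAction_comparison (X : C) :
    l.oppLaw.fstAction (l.comparison.obj X) = l.hom.app X ≫ F.μ.app X := by
  have h1 := F.unit_naturality _ (l.hom.app X ≫ F.μ.app X)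
  have h2 := F.left_unit X
  change F.η.app (F.obj (F.obj X)) ≫ F.map (l.hom.app X) ≫ F.map (F.μ.app X) ≫ F.μ.app X = _
  simp only [Functor.map_comp, Category.assoc, Functor.comp_obj, Functor.id_obj] at *
  rw [← reassoc_of% h1, h2, Category.comp_id]

lemma sndAction_comparison (X : C) :
    l.oppLaw.sndAction (l.comparison.obj X) = F.μ.app X := by
  have h1 := congrArg F.map (l.unit_left X)
  have h2 : F.map (F.map (F.η.app X)) ≫ F.map (F.μ.app X) = 𝟙 (F.obj (F.obj X)) :=
    (F.map_comp _ _).symm.trans ((congrArg F.map (F.right_unit X)).trans (F.map_id _))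
  change F.map (F.η.app (F.obj X)) ≫ F.map (l.hom.app X) ≫ F.map (F.μ.app X) ≫ F.μ.app X = _
  simp only [Functor.map_comp, Functor.comp_obj, Functor.id_obj] at *
  rw [reassoc_of% h1, reassoc_of% h2]

lemma comparison_hom_fst {X Y : C} (g : l.comparison.obj X ⟶ l.comparison.obj Y) :
    F.map g.f ≫ l.hom.app Y ≫ F.μ.app Y = (l.hom.app X ≫ F.μ.app X) ≫ g.f := by
  have h := DistribLaw.hom_fstAction (l := l.oppLaw) g
  exact (congrArg (F.map g.f ≫ ·) (l.fstAction_comparison Y)).symm.trans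
    (h.trans (congrArg (· ≫ g.f) (l.fstAction_comparison X)))

lemma comparison_hom_snd {X Y : C} (g : l.comparison.obj X ⟶ l.comparison.obj Y) :
    F.map g.f ≫ F.μ.app Y = F.μ.app X ≫ g.f := by
  have h := DistribLaw.hom_sndAction (l := l.oppLaw) g
  exact (congrArg (F.map g.f ≫ ·) (l.sndAction_comparison Y)).symm.trans
    (h.trans (congrArg (· ≫ g.f) (l.sndAction_comparison X)))

/-- If the unit of `F` splits, bimodule morphisms between free modules come from morphisms, as
soon as the pairing on the target is injective. -/
lemma exists_map_eq_of_pairing (e : F.toFunctor ⟶ 𝟭 C) (he : ∀ X, F.η.app X ≫ e.app X = 𝟙 X)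
    {X Y : C} (inj : ∀ Z, Function.Injective (pairing (l.hom.app Y ≫ F.μ.app Y) Z))
    (g : F.obj X ⟶ F.obj Y) (h1 : F.map g ≫ l.hom.app Y ≫ F.μ.app Y = (l.hom.app X ≫ F.μ.app X) ≫ g)
    (h2 : F.map g ≫ F.μ.app Y = F.μ.app X ≫ g) : ∃ f : X ⟶ Y, F.map f = g := by
  -- A bimodule morphism is recovered from its restriction `w` along the unit in two ways, once
  -- through each action.
  have hg : F.map (F.η.app X ≫ g) ≫ F.μ.app Y = g := by
    have a1 := F.right_unit X
    simp only [Functor.map_comp, Category.assoc, Functor.comp_obj, Functor.id_obj] at *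
    rw [h2, reassoc_of% a1]
  have hg' : F.map (F.η.app X ≫ g) ≫ l.hom.app Y ≫ F.μ.app Y = g := by
    have a1 := F.right_unit X
    have a2 := l.unit_right X
    have a3 := F.left_unit X
    simp only [Functor.map_comp, Category.assoc, Functor.comp_obj, Functor.id_obj] at *
    rw [h1, reassoc_of% a2, reassoc_of% a3]
  generalize hw : F.η.app X ≫ g = w at *
  -- Both sides have pairing `g`, the left by `hg'` and the right by `hg`.
  have key : w ≫ F.η.app (F.obj Y) = w ≫ F.map (F.η.app Y) := by
    apply inj
    have a1 := F.right_unit (F.obj Y)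
    have a2 := F.mu_naturality _ (F.η.app Y)
    have a3 := l.unit_right Y
    have a4 := F.left_unit Y
    simp only [pairing, Functor.map_comp, Category.assoc, Functor.comp_obj, Functor.id_obj] at *
    rw [reassoc_of% a1, reassoc_of% a2, reassoc_of% a3, a4, Category.comp_id, hg, hg']
  refine ⟨w ≫ e.app Y, ?_⟩
  -- Descent: naturality of `e` splits the fork of `η_F` and `F η`, so a map equalizing them factors
  -- through the unit of `Y`.
  have h3 : (w ≫ e.app Y) ≫ F.η.app Y = w := by
    have a1 := e.naturality (F.η.app Y)
    have a2 := he (F.obj Y)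
    simp only [Category.assoc, Functor.id_obj, Functor.id_map] at *
    rw [← a1, ← reassoc_of% key, a2, Category.comp_id]
  have a1 := F.right_unit Y
  have h4 := congrArg (fun f => F.map f ≫ F.μ.app Y) h3
  simp only [Functor.map_comp, Category.assoc, Functor.comp_obj, Functor.id_obj] at *
  rw [← hg, ← h4, a1, Category.comp_id]

variable [IsIso l.hom]

/-- If the unit of `F` splits, a bimodule with perfect pairing is free. -/
lemma exists_iso_of_pairing [IsIdempotentComplete C] (e : F.toFunctor ⟶ 𝟭 C)
    (he : ∀ X, F.η.app X ≫ e.app X = 𝟙 X) {A : C} (h r : F.obj A ⟶ A)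
    (h_assoc : l.hom.app A ≫ F.μ.app A ≫ h = F.map h ≫ h)
    (r_unit : F.η.app A ≫ r = 𝟙 A) (r_assoc : F.μ.app A ≫ r = F.map r ≫ r)
    (compat : F.map r ≫ h = l.hom.app A ≫ F.map h ≫ r)
    (bij : ∀ Z, Function.Bijective (pairing h Z))
    (inj : ∀ Z, Function.Injective (pairing (l.hom.app A ≫ F.μ.app A) Z)) :
    ∃ (X : C) (φ : F.obj X ≅ A), F.map φ.hom ≫ h = (l.hom.app X ≫ F.μ.app X) ≫ φ.hom ∧
      F.map φ.hom ≫ r = F.μ.app X ≫ φ.hom := by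
  -- The perfect pairing represents the second action: `r = F.map σ ≫ F.μ ≫ h`.
  obtain ⟨σ, hσ⟩ := (bij A).2 r
  have σ1 : σ ≫ h = 𝟙 A := by
    rw [← r_unit, ← hσ]
    have a1 := F.unit_naturality _ σ
    have a2 := F.left_unit A
    simp only [pairing, Functor.comp_obj, Functor.id_obj] at *
    rw [← reassoc_of% a1, reassoc_of% a2]
  -- `σ2` and `σ3` say that `σ` is a bimodule morphism from `A` to the regular bimodule on `A`; both
  -- are tested after pairing.
  have σ2 : h ≫ σ = F.map σ ≫ l.hom.app A ≫ F.μ.app A := by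
    apply (bij (F.obj A)).1
    have a1 : F.map (F.map σ) ≫ F.map (l.hom.app A) ≫ F.map (F.μ.app A) ≫ F.μ.app A ≫ h =
        F.map h ≫ r := by
      -- Precomposing with the invertible `λ` produces the right side of `compat`.
      rw [← cancel_epi (l.hom.app A), ← compat, ← hσ]
      have a2 := l.nat σ
      have a3 := l.mul_right A
      have a4 := F.assoc A
      simp only [pairing, Functor.map_comp, Category.assoc, Functor.comp_obj] at *
      rw [← reassoc_of% a2, reassoc_of% a4, ← reassoc_of% a3, h_assoc]
    simp only [pairing, Functor.map_comp, Category.assoc] at *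
    rw [hσ, a1]
  have σ3 : r ≫ σ = F.map σ ≫ F.μ.app A := by
    apply (bij (F.obj A)).1
    have a3 := F.mu_naturality _ σ
    have a4 := F.assoc A
    simp only [pairing, Functor.map_comp, Category.assoc, Functor.comp_obj] at *
    rw [hσ, reassoc_of% a4, reassoc_of% a3, hσ, r_assoc]
  -- Both sides pair to `r ≫ σ`.
  have σ4 : σ ≫ F.map (F.η.app A) = σ ≫ F.map σ := by
    apply inj
    have a1 := F.mu_naturality _ (F.η.app A)
    have a2 := l.unit_right A
    have a3 := F.left_unit A
    have a4 := F.mu_naturality _ σ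
    simp only [pairing, Functor.map_comp, Category.assoc, Functor.comp_obj, Functor.id_obj] at *
    rw [reassoc_of% a1, reassoc_of% a2, a3, Category.comp_id, reassoc_of% a4, ← σ2, ← σ3,
      reassoc_of% hσ]
  -- `σ ≫ e` projects onto the equalizer of `η_A` and `σ`, the analogue of the centralizer. `u1`
  -- puts its image in the equalizer, and `u2` follows since `e` retracts the unit.
  have u1 : (σ ≫ e.app A) ≫ F.η.app A = (σ ≫ e.app A) ≫ σ := by
    have a1 := e.naturality (F.η.app A)
    have a2 := e.naturality σ
    simp only [Category.assoc, Functor.id_obj, Functor.id_map] at *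
    rw [← a1, ← a2, reassoc_of% σ4]
  have u2 : (σ ≫ e.app A) ≫ (σ ≫ e.app A) = σ ≫ e.app A := by
    have a1 := he A
    rw [← Category.assoc _ σ, ← u1, Category.assoc _ (F.η.app A)]
    simp only [Functor.id_obj] at *
    rw [a1, Category.comp_id]
  obtain ⟨X, i, q, hi, hq⟩ := IsIdempotentComplete.idempotents_split A _ u2
  have v1 : i ≫ F.η.app A = i ≫ σ := by
    have : i = i ≫ σ ≫ e.app A := by rw [← hq, reassoc_of% hi]
    rw [this]
    simp only [Category.assoc, Functor.id_obj] at u1 ⊢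
    rw [u1]
  -- On the centralizer the two actions coincide, as `r` is represented by `σ` and `σ` agrees there
  -- with the unit.
  have v2 : F.map i ≫ h = F.map i ≫ r := by
    have a1 := F.right_unit A
    have a2 := congrArg F.map v1
    simp only [pairing, Functor.map_comp, Functor.comp_obj, Functor.id_obj] at *
    rw [← hσ, ← reassoc_of% a2, reassoc_of% a1]
  refine ⟨X, ⟨F.map i ≫ h, σ ≫ F.map q, ?_, ?_⟩, ?_, ?_⟩
  · have a1 := congrArg F.map v1
    have a2 := l.unit_right A
    have a3 := F.left_unit A
    have a4 := congrArg F.map hi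
    simp only [Functor.map_comp, Category.assoc, Functor.comp_obj, Functor.id_obj] at *
    rw [reassoc_of% σ2, ← reassoc_of% a1, reassoc_of% a2, reassoc_of% a3, a4]
    exact F.map_id X
  · have a1 := congrArg F.map hq
    have a2 : F.map (F.η.app A) ≫ F.map (e.app A) = 𝟙 (F.obj A) :=
      (F.map_comp _ _).symm.trans ((congrArg F.map (he A)).trans (F.map_id _))
    simp only [Functor.map_comp, Category.assoc, Functor.id_obj] at *
    rw [reassoc_of% a1, ← reassoc_of% σ4, reassoc_of% a2, σ1]
  · have a1 := l.nat i
    have a2 := F.mu_naturality _ i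
    simp only [Functor.map_comp, Category.assoc] at *
    rw [← h_assoc, reassoc_of% a1, reassoc_of% a2]
  · have a2 := F.mu_naturality _ i
    simp only [v2, Functor.map_comp, Category.assoc] at *
    rw [← r_assoc, reassoc_of% a2]

/-! ### Galois with split unit implies Azumaya -/

section Galois

variable {R : Comonad C} (p : AdjointPair F R)

/-- The component at a module of the Galois map of the free functor. -/
noncomputable def galoisApp (M : l.opp.Algebra) : F.obj M.A ⟶ R.obj M.A :=
  (((l.freeCoaction p).galoisMap l.opp.adj).app M).f

/-- The action enters as a separate `h` so that its type mentions `F`; the functor of the opposite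
monad is `F` only after unfolding, and would obstruct rewriting. -/
lemma galoisApp_eq (M : l.opp.Algebra) (h : F.obj M.A ⟶ M.A) (hM : M.a = h) :
    l.galoisApp p M = p.adj.unit.app (F.obj M.A) ≫ R.map (F.μ.app M.A) ≫ R.map h := by
  subst hM
  have h1 : l.galoisApp p M = (p.adj.unit.app (F.obj M.A) ≫ R.map (F.μ.app M.A)) ≫
    R.map (l.opp.adj.counit.app M).f := rfl
  rw [h1, l.opp.adj_counit_app_f]
  exact Category.assoc _ _ _

/-- The transpose of the Galois map along `F ⊣ R` is `h · m`. Later computations with the Galois map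
go through this equation. -/
lemma galoisApp_counit (M : l.opp.Algebra) (h : F.obj M.A ⟶ M.A) (hM : M.a = h) :
    F.map (l.galoisApp p M) ≫ p.adj.counit.app M.A = F.μ.app M.A ≫ h := by
  rw [l.galoisApp_eq p M h hM]
  simp

lemma freeIsGalois_iff : l.FreeIsGalois p ↔ ∀ M : l.opp.Algebra, IsIso (l.galoisApp p M) := by
  constructor
  · intro (H : IsIso _) M
    exact inferInstanceAs (IsIso (l.opp.forget.map
      (((l.freeCoaction p).galoisMap l.opp.adj).app M)))
  · intro H
    have : ∀ M, IsIso (((l.freeCoaction p).galoisMap l.opp.adj).app M) := fun M => by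
      have : IsIso (l.opp.forget.map (((l.freeCoaction p).galoisMap l.opp.adj).app M)) := H M
      exact isIso_of_reflects_iso _ l.opp.forget
    exact NatIso.isIso_of_isIso_app _

variable {l p}

/-- By transposition along `F ⊣ R`, the pairing becomes composition with the Galois map at `(A, h)`,
which is invertible. -/
lemma FreeIsGalois.pairing_bijective (H : l.FreeIsGalois p) {A : C} (h : F.obj A ⟶ A)
    (h_unit : F.η.app A ≫ h = 𝟙 A) (h_assoc : l.hom.app A ≫ F.μ.app A ≫ h = F.map h ≫ h) (Z : C) :
    Function.Bijective (pairing h Z) := by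
  let M : l.opp.Algebra := ⟨A, h, h_unit, (Category.assoc _ _ _).trans h_assoc⟩
  have : IsIso (l.galoisApp p M) := (l.freeIsGalois_iff p).1 H M
  have key : ∀ t : Z ⟶ F.obj A,
      pairing h Z t = (p.adj.homEquiv Z A).symm (t ≫ l.galoisApp p M) := fun t => by
    have := l.galoisApp_counit p M h rfl
    rw [Adjunction.homEquiv_counit, F.map_comp, Category.assoc]
    exact congrArg (F.map t ≫ ·) this.symm
  refine ⟨fun s t hst => ?_, fun g => ⟨p.adj.homEquiv Z A g ≫ inv (l.galoisApp p M), ?_⟩⟩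
  · rw [key, key] at hst
    exact (cancel_mono (l.galoisApp p M)).1 ((p.adj.homEquiv Z A).symm.injective hst)
  · rw [key, Category.assoc]
    exact (congrArg (p.adj.homEquiv Z A).symm (by simp)).trans ((p.adj.homEquiv Z A).left_inv g)

/-- If the free functor is Galois and the unit splits, then `(F, λ)` is Azumaya. -/
theorem FreeIsGalois.isAzumaya [IsIdempotentComplete C] (H : l.FreeIsGalois p)
    (hs : IsSplitMono F.η) : l.IsAzumaya := by
  obtain ⟨⟨e, he⟩⟩ := hs
  have he : ∀ X, F.η.app X ≫ e.app X = 𝟙 X := fun X => NatTrans.congr_app he X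
  -- The action `m · λ` is that of the free `F^λ`-module on `Y`, so the Galois hypothesis applies to
  -- it.
  have inj : ∀ Y Z, Function.Injective (pairing (l.hom.app Y ≫ F.μ.app Y) Z) := fun Y Z =>
    (H.pairing_bijective _ (l.opp.left_unit Y)
      ((Category.assoc _ _ _).symm.trans (l.opp.assoc Y).symm) Z).1
  refine { faithful := ⟨fun {X Y f g} hfg => ?_⟩, full := ⟨fun {X Y} g => ?_⟩,
           essSurj := ⟨fun M => ?_⟩ }
  · have h1 : F.map f = F.map g := congrArg Monad.Algebra.Hom.f hfg
    have h2 := F.unit_naturality _ f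
    have h3 := F.unit_naturality _ g
    rw [← Category.comp_id f, ← Category.comp_id g, ← he Y, reassoc_of% h2, reassoc_of% h3, h1]
  · obtain ⟨f, hf⟩ := l.exists_map_eq_of_pairing e he (inj Y) g.f (l.comparison_hom_fst g)
      (l.comparison_hom_snd g)
    exact ⟨f, Monad.Algebra.Hom.ext hf⟩
  · have h_assoc : l.hom.app M.A ≫ F.μ.app M.A ≫ l.oppLaw.fstAction M =
        F.map (l.oppLaw.fstAction M) ≫ l.oppLaw.fstAction M :=
      (Category.assoc _ _ _).symm.trans (l.oppLaw.fstAction_assoc M)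
    obtain ⟨X, φ, h1, h2⟩ := l.exists_iso_of_pairing e he (A := M.A) (l.oppLaw.fstAction M)
      (l.oppLaw.sndAction M) h_assoc (l.oppLaw.sndAction_unit M)
      (l.oppLaw.sndAction_assoc M)
      ((l.oppLaw.action_compat M).trans (congrArg (l.hom.app M.A ≫ ·) (l.oppLaw.action_eq M).symm))
      (H.pairing_bijective _ (l.oppLaw.fstAction_unit M) h_assoc) (inj M.A)
    let ψ : l.comparison.obj X ⟶ M := DistribLaw.homOfPair (l := l.oppLaw) φ.hom
      (by rw [l.fstAction_comparison X]; exact h1) (by rw [l.sndAction_comparison X]; exact h2)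
    have : IsIso (l.double.forget.map ψ) := inferInstanceAs (IsIso φ.hom)
    have : IsIso ψ := isIso_of_reflects_iso ψ l.double.forget
    exact ⟨X, ⟨asIso ψ⟩⟩

end Galois

end BDLaw

/-! ### Azumaya implies Galois -/

namespace BDLaw

variable {F : Monad C} (l : BDLaw F) [IsIso l.hom] {R : Comonad C} (p : AdjointPair F R)

/-- The action of `F` on its right adjoint. -/
def rightAdjointAction (A : C) : F.obj (R.obj A) ⟶ R.obj A :=
  p.adj.unit.app (F.obj (R.obj A)) ≫ R.map (F.μ.app (R.obj A) ≫ p.adj.counit.app A)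

/-- In the model case `R A` is `Hom(B, A)`, and this is the formula `(b f)(x) = f(x b)`. -/
lemma rightAdjointAction_counit (A : C) :
    F.map (rightAdjointAction p A) ≫ p.adj.counit.app A =
      F.μ.app (R.obj A) ≫ p.adj.counit.app A := by
  simp [rightAdjointAction]

lemma rightAdjointAction_unit (A : C) :
    F.η.app (R.obj A) ≫ rightAdjointAction p A = 𝟙 (R.obj A) := by
  apply adj_ext p.adj
  have h1 := F.right_unit (R.obj A)
  simp only [Functor.map_comp, Category.assoc, Functor.id_obj] at *
  rw [rightAdjointAction_counit, reassoc_of% h1]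
  simp

lemma rightAdjointAction_assoc (A : C) :
    F.μ.app (R.obj A) ≫ rightAdjointAction p A =
      F.map (rightAdjointAction p A) ≫ rightAdjointAction p A := by
  apply adj_ext p.adj
  have h1 := F.mu_naturality _ (rightAdjointAction p A)
  have h2 := F.assoc (R.obj A)
  have h3 := rightAdjointAction_counit p A
  simp only [Functor.map_comp, Category.assoc, Functor.comp_obj, Functor.id_obj] at *
  rw [h3, reassoc_of% h1, h3, reassoc_of% h2]

/-- The lifted action of the opposite monad on `R A`. -/
noncomputable def liftAction (M : l.opp.Algebra) : F.obj (R.obj M.A) ⟶ R.obj M.A :=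
  ((l.liftComonad p).obj M).a

/-- In the model case this is `(f b)(x) = f(x) b`; the inverse of `λ` moves `b` past the argument.
-/
lemma liftAction_counit (M : l.opp.Algebra) (h : F.obj M.A ⟶ M.A) (hM : M.a = h) :
    F.map (l.liftAction p M) ≫ p.adj.counit.app M.A =
      (inv l.hom).app (R.obj M.A) ≫ F.map (p.adj.counit.app M.A) ≫ h := by
  subst hM
  have h1 := l.oppLaw.inv.mate_counit p M.A
  have h2 := adj_counit_nat p.adj (X := F.obj M.A) M.a
  change F.map ((l.mixed p).hom.app M.A ≫ R.map M.a) ≫ p.adj.counit.app M.A = _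
  have h3 : F.map ((l.mixed p).hom.app M.A) ≫ p.adj.counit.app (F.obj M.A) =
    (inv l.hom).app (R.obj M.A) ≫ F.map (p.adj.counit.app M.A) := h1
  rw [F.map_comp, Category.assoc]
  exact (congrArg (F.map ((l.mixed p).hom.app M.A) ≫ ·) h2).trans
    ((Category.assoc _ _ _).symm.trans ((congrArg (· ≫ M.a) h3).trans (Category.assoc _ _ _)))

/-- One action works on the argument and the other on the value, so they commute up to `λ`. After
transposing, the content is naturality of `λ⁻¹` and its compatibility with the multiplication. -/
lemma liftAction_compat (M : l.opp.Algebra) :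
    F.map (rightAdjointAction p M.A) ≫ l.liftAction p M =
      l.hom.app (R.obj M.A) ≫ F.map (l.liftAction p M) ≫ rightAdjointAction p M.A := by
  apply adj_ext p.adj
  obtain ⟨h, hM⟩ : ∃ h : F.obj M.A ⟶ M.A, M.a = h := ⟨_, rfl⟩
  have h1 := l.liftAction_counit p M h hM
  have h2 := rightAdjointAction_counit p M.A
  generalize l.liftAction p M = χ at *
  generalize rightAdjointAction p M.A = r at *
  have h3 := (inv l.hom).naturality r
  have h4 := congrArg F.map h2
  have h5 : (inv l.hom).app (F.obj (R.obj M.A)) ≫ F.map (F.μ.app (R.obj M.A)) =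
      F.map (l.hom.app (R.obj M.A)) ≫ F.μ.app (F.obj (R.obj M.A)) ≫
        (inv l.hom).app (R.obj M.A) := by
    rw [← cancel_epi (l.hom.app (F.obj (R.obj M.A))), ← cancel_mono (l.hom.app (R.obj M.A))]
    have := l.mul_right (R.obj M.A)
    simp only [Functor.comp_obj] at *
    simp [this]
  have h6 := F.mu_naturality _ χ
  simp only [Functor.map_comp, Category.assoc, Functor.comp_obj, Functor.comp_map] at *
  rw [h1, reassoc_of% h3, reassoc_of% h4, reassoc_of% h5, h2, reassoc_of% h6, h1]

/-- The bimodule `R A`. -/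
noncomputable def rightAdjointBimodule (M : l.opp.Algebra) : l.double.Algebra :=
  l.oppLaw.algebraOfPair (R.obj M.A) (l.liftAction p M) (rightAdjointAction p M.A)
    ((l.liftComonad p).obj M).unit ((l.liftComonad p).obj M).assoc
    (rightAdjointAction_unit p M.A) (rightAdjointAction_assoc p M.A) (l.liftAction_compat p M)

lemma fstAction_rightAdjointBimodule (M : l.opp.Algebra) :
    l.oppLaw.fstAction (l.rightAdjointBimodule p M) = l.liftAction p M :=
  DistribLaw.fstAction_algebraOfPair ..

lemma sndAction_rightAdjointBimodule (M : l.opp.Algebra) :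
    l.oppLaw.sndAction (l.rightAdjointBimodule p M) = rightAdjointAction p M.A :=
  DistribLaw.sndAction_algebraOfPair ..

/-- Linearity over `F^λ` is part of the Galois map being a morphism of modules; linearity over `F`
is the separate computation that follows. -/
lemma galoisApp_linear (M : l.opp.Algebra) :
    F.map (l.galoisApp p M) ≫ l.liftAction p M =
      (l.hom.app M.A ≫ F.μ.app M.A) ≫ l.galoisApp p M :=
  (((l.freeCoaction p).galoisMap l.opp.adj).app M).h

lemma galoisApp_linear' (M : l.opp.Algebra) :
    F.map (l.galoisApp p M) ≫ rightAdjointAction p M.A = F.μ.app M.A ≫ l.galoisApp p M := by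
  apply adj_ext p.adj
  obtain ⟨h, hM⟩ : ∃ h : F.obj M.A ⟶ M.A, M.a = h := ⟨_, rfl⟩
  have h1 := l.galoisApp_counit p M h hM
  have h2 := rightAdjointAction_counit p M.A
  generalize rightAdjointAction p M.A = r at *
  generalize l.galoisApp p M = g at *
  have h3 := F.mu_naturality _ g
  have h4 := F.assoc M.A
  simp only [Functor.map_comp, Category.assoc, Functor.comp_obj] at *
  rw [h1, h2, reassoc_of% h3, h1, reassoc_of% h4]

/-- The Galois map as a bimodule morphism. -/
noncomputable def galoisHom (M : l.opp.Algebra) :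
    l.comparison.obj M.A ⟶ l.rightAdjointBimodule p M :=
  DistribLaw.homOfPair (l := l.oppLaw) (l.galoisApp p M)
    (by
      rw [l.fstAction_comparison, l.fstAction_rightAdjointBimodule]
      exact l.galoisApp_linear p M)
    (by
      rw [l.sndAction_comparison, l.sndAction_rightAdjointBimodule]
      exact l.galoisApp_linear' p M)

/-- Bimodule morphisms from a free module to `R A` factor through the Galois map. -/
lemma eq_map_comp_galoisHom (M : l.opp.Algebra) {X : C}
    (ψ : l.comparison.obj X ⟶ l.rightAdjointBimodule p M) :
    ∃ s : X ⟶ M.A, ψ = l.comparison.map s ≫ l.galoisHom p M := by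
  obtain ⟨f, hf⟩ : ∃ f : F.obj X ⟶ R.obj M.A, ψ.f = f := ⟨_, rfl⟩
  have h1 : F.map f ≫ l.liftAction p M = (l.hom.app X ≫ F.μ.app X) ≫ f := by
    have := DistribLaw.hom_fstAction (l := l.oppLaw) ψ
    rw [l.fstAction_comparison, l.fstAction_rightAdjointBimodule] at this
    rw [← hf]
    exact this
  have h2 : F.map f ≫ rightAdjointAction p M.A = F.μ.app X ≫ f := by
    have := DistribLaw.hom_sndAction (l := l.oppLaw) ψ
    rw [l.sndAction_comparison, l.sndAction_rightAdjointBimodule] at this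
    rw [← hf]
    exact this
  -- The counit of `R` is evaluation at the unit, so `s` restricts `f` along the unit and then
  -- evaluates at the unit.
  refine ⟨F.η.app X ≫ f ≫ R.ε.app M.A, Monad.Algebra.Hom.ext (hf.trans ?_)⟩
  change f = F.map (F.η.app X ≫ f ≫ R.ε.app M.A) ≫ l.galoisApp p M
  obtain ⟨h, hM⟩ : ∃ h : F.obj M.A ⟶ M.A, M.a = h := ⟨_, rfl⟩
  have h3 := l.galoisApp_counit p M h hM
  have h4 := rightAdjointAction_counit p M.A
  have hε : F.map (R.ε.app M.A) ≫ h = l.liftAction p M ≫ R.ε.app M.A := by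
    rw [← hM]
    exact ((l.liftComonad p).ε.app M).h
  generalize l.galoisApp p M = γ at *
  generalize rightAdjointAction p M.A = r at *
  generalize l.liftAction p M = χ at *
  -- `f ≫ ε` is `F^λ`-linear out of a free module, hence determined by its restriction `s`.
  have h5 : f ≫ R.ε.app M.A = F.map (F.η.app X ≫ f ≫ R.ε.app M.A) ≫ h := by
    have a1 := l.unit_right X
    have a2 := F.left_unit X
    simp only [Functor.map_comp, Category.assoc, Functor.comp_obj, Functor.id_obj] at *
    rw [hε, reassoc_of% h1, reassoc_of% a1, reassoc_of% a2]
  generalize F.η.app X ≫ f ≫ R.ε.app M.A = s at *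
  apply adj_ext p.adj
  have a1 := p.counit_eq M.A
  have a2 := congrArg (fun f => F.map f ≫ p.adj.counit.app M.A) h2
  have a3 := F.mu_naturality _ f
  have a4 := F.mu_naturality _ s
  have a5 := F.unit_naturality _ (F.map f)
  have a6 := F.unit_naturality _ (F.μ.app X)
  have a7 := F.left_unit X
  have a8 := F.left_unit (F.obj X)
  have a9 := F.unit_naturality _ f
  simp only [Functor.map_comp, Category.assoc, Functor.comp_obj, Functor.id_obj] at *
  -- Linearity over `F` determines `f` from `f ≫ ε`: its transpose is `F.μ ≫ f ≫ ε`.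
  rw [h4, reassoc_of% a3] at a2
  rw [h3, reassoc_of% a4, ← h5, a1, reassoc_of% a9, reassoc_of% a6, ← a2, reassoc_of% a8]

variable {l p}

/-- The free functor of an Azumaya monad is Galois. -/
theorem IsAzumaya.freeIsGalois (H : l.IsAzumaya) : l.FreeIsGalois p := by
  have : l.comparison.IsEquivalence := H
  rw [freeIsGalois_iff]
  intro M
  obtain ⟨X, ⟨ψ⟩⟩ : ∃ X, Nonempty (l.comparison.obj X ≅ l.rightAdjointBimodule p M) :=
    ⟨_, ⟨l.comparison.objObjPreimageIso _⟩⟩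
  obtain ⟨s, hs⟩ := l.eq_map_comp_galoisHom p M ψ.hom
  obtain ⟨r, hr⟩ := l.comparison.map_surjective (l.galoisHom p M ≫ ψ.inv)
  have h1 : s ≫ r = 𝟙 X := by
    apply l.comparison.map_injective
    rw [Functor.map_comp, hr, ← reassoc_of% hs, ψ.hom_inv_id, CategoryTheory.Functor.map_id]
  -- Here `K (r ≫ s) ≫ γ = γ`, writing `K` for the comparison and `γ` for the Galois map.
  -- Faithfulness does not suffice, since `γ` is not yet known to be monic; instead the equation is
  -- transposed and evaluated at two units.
  have h2 : r ≫ s = 𝟙 M.A := by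
    obtain ⟨h, hM⟩ : ∃ h : F.obj M.A ⟶ M.A, M.a = h := ⟨_, rfl⟩
    have h3 : l.comparison.map (r ≫ s) ≫ l.galoisHom p M = l.galoisHom p M := by
      rw [Functor.map_comp, hr, Category.assoc, Category.assoc, ← hs, ψ.inv_hom_id,
        Category.comp_id]
    have h4 : F.map (r ≫ s) ≫ l.galoisApp p M = l.galoisApp p M :=
      congrArg Monad.Algebra.Hom.f h3
    have h5 := l.galoisApp_counit p M h hM
    have h6 := congrArg (fun f => F.map f ≫ p.adj.counit.app M.A) h4
    have h7 : F.η.app M.A ≫ h = 𝟙 M.A := by rw [← hM]; exact M.unit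
    have a1 := F.mu_naturality _ (r ≫ s)
    have a2 := F.unit_naturality _ (F.map (r ≫ s))
    have a3 := F.unit_naturality _ (r ≫ s)
    have a4 := F.left_unit M.A
    generalize r ≫ s = t at *
    simp only [Functor.map_comp, Category.assoc, Functor.comp_obj, Functor.id_obj] at *
    rw [h5, reassoc_of% a1] at h6
    have h8 := congrArg (fun f => F.η.app M.A ≫ F.η.app (F.obj M.A) ≫ f) h6
    simp only [reassoc_of% a4, h7] at h8
    rw [← reassoc_of% a3, h7, Category.comp_id] at h8
    exact h8
  have : IsIso r := ⟨s, h2, h1⟩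
  have : IsIso (l.galoisHom p M) := by
    rw [show l.galoisHom p M = l.comparison.map r ≫ ψ.hom by rw [hr]; simp]
    infer_instance
  exact inferInstanceAs (IsIso (l.double.forget.map (l.galoisHom p M)))

end BDLaw

/-! ### Azumaya comonads and Galois cofree functors -/

namespace CoBDLaw

variable {G : Comonad C} (k : CoBDLaw G)

/-- The copairing `A ⟶ G A ⊗ G A` of a comodule `(A, θ)` over the opposite comonad, viewed as a
map on generalized coelements of `G A`. -/
def copairing {A : C} (θ : A ⟶ G.obj A) (X : C) (t : G.obj A ⟶ X) : A ⟶ G.obj X :=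
  θ ≫ G.δ.app A ≫ G.map t

/-- With the next lemma: the comparison object is the regular bicomodule, with coactions `κ · δ` and
`δ`. -/
lemma fstCoaction_comparison (X : C) :
    k.oppLaw.fstCoaction (k.comparison.obj X) = G.δ.app X ≫ k.hom.app X := by
  have h1 := G.counit_naturality _ (G.δ.app X ≫ k.hom.app X)
  have h2 := G.left_counit X
  change (G.δ.app X ≫ G.map (G.δ.app X) ≫ G.map (k.hom.app X)) ≫
    G.ε.app (G.obj (G.obj X)) = _
  simp only [Functor.map_comp, Category.assoc, Functor.comp_obj, Functor.id_obj] at *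
  rw [h1, reassoc_of% h2]

lemma sndCoaction_comparison (X : C) :
    k.oppLaw.sndCoaction (k.comparison.obj X) = G.δ.app X := by
  have h1 := congrArg G.map (k.counit_right X)
  have h2 : G.map (G.δ.app X) ≫ G.map (G.map (G.ε.app X)) = 𝟙 (G.obj (G.obj X)) :=
    (G.map_comp _ _).symm.trans ((congrArg G.map (G.right_counit X)).trans (G.map_id _))
  change (G.δ.app X ≫ G.map (G.δ.app X) ≫ G.map (k.hom.app X)) ≫ G.map (G.ε.app (G.obj X)) = _
  simp only [Functor.map_comp, Category.assoc, Functor.comp_obj, Functor.id_obj] at *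
  rw [h1, h2, Category.comp_id]

lemma comparison_hom_fst {X Y : C} (g : k.comparison.obj X ⟶ k.comparison.obj Y) :
    G.δ.app X ≫ k.hom.app X ≫ G.map g.f = g.f ≫ G.δ.app Y ≫ k.hom.app Y := by
  have h := CodistribLaw.hom_fstCoaction (k := k.oppLaw) g
  exact (Category.assoc _ _ _).symm.trans
    ((congrArg (· ≫ G.map g.f) (k.fstCoaction_comparison X)).symm.trans
      (h.trans (congrArg (g.f ≫ ·) (k.fstCoaction_comparison Y))))

lemma comparison_hom_snd {X Y : C} (g : k.comparison.obj X ⟶ k.comparison.obj Y) :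
    G.δ.app X ≫ G.map g.f = g.f ≫ G.δ.app Y := by
  have h := CodistribLaw.hom_sndCoaction (k := k.oppLaw) g
  exact (congrArg (· ≫ G.map g.f) (k.sndCoaction_comparison X)).symm.trans
    (h.trans (congrArg (g.f ≫ ·) (k.sndCoaction_comparison Y)))

/-- If the counit of `G` splits, bicomodule morphisms between cofree comodules come from
morphisms, as soon as the copairing on the source is injective. -/
lemma exists_map_eq_of_copairing (e : 𝟭 C ⟶ G.toFunctor) (he : ∀ X, e.app X ≫ G.ε.app X = 𝟙 X)
    {X Y : C} (inj : ∀ Z, Function.Injective (copairing (G.δ.app X ≫ k.hom.app X) Z))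
    (g : G.obj X ⟶ G.obj Y)
    (h1 : G.δ.app X ≫ k.hom.app X ≫ G.map g = g ≫ G.δ.app Y ≫ k.hom.app Y)
    (h2 : G.δ.app X ≫ G.map g = g ≫ G.δ.app Y) : ∃ f : X ⟶ Y, G.map f = g := by
  have hg : G.δ.app X ≫ G.map (g ≫ G.ε.app Y) = g := by
    have a1 := G.right_counit Y
    simp only [Functor.map_comp, Functor.comp_obj, Functor.id_obj] at *
    rw [reassoc_of% h2, a1, Category.comp_id]
  have hg' : G.δ.app X ≫ k.hom.app X ≫ G.map (g ≫ G.ε.app Y) = g := by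
    have a2 := k.counit_left Y
    have a3 := G.left_counit Y
    simp only [Functor.map_comp, Functor.comp_obj, Functor.id_obj] at *
    rw [reassoc_of% h1, a2, a3, Category.comp_id]
  generalize hw : g ≫ G.ε.app Y = w at *
  -- Both sides have copairing `g`, which is recovered from `w` through either coaction.
  have key : G.ε.app (G.obj X) ≫ w = G.map (G.ε.app X) ≫ w := by
    apply inj
    have a1 := G.right_counit (G.obj X)
    have a2 := G.delta_naturality _ (G.ε.app X)
    have a3 := k.counit_left X
    have a4 := G.left_counit X
    simp only [copairing, Functor.map_comp, Category.assoc, Functor.comp_obj, Functor.id_obj] at *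
    rw [reassoc_of% a1, ← reassoc_of% a2, reassoc_of% a3, reassoc_of% a4, hg, hg']
  refine ⟨e.app X ≫ w, ?_⟩
  -- A map coequalizing `ε_G` and `G ε` factors through the counit, because `e` splits the cofork.
  have h3 : G.ε.app X ≫ e.app X ≫ w = w := by
    have a1 := e.naturality (G.ε.app X)
    have a2 := he (G.obj X)
    simp only [Functor.id_obj, Functor.id_map] at *
    rw [reassoc_of% a1, ← key, reassoc_of% a2]
  have a1 := G.right_counit X
  have h4 := congrArg (fun f => G.δ.app X ≫ G.map f) h3
  simp only [Functor.map_comp, Functor.comp_obj, Functor.id_obj] at *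
  rw [← hg, ← h4, reassoc_of% a1]

variable [IsIso k.hom]

/-- If the counit of `G` splits, a bicomodule with perfect copairing is cofree. -/
lemma exists_iso_of_copairing [IsIdempotentComplete C] (e : 𝟭 C ⟶ G.toFunctor)
    (he : ∀ X, e.app X ≫ G.ε.app X = 𝟙 X) {A : C} (h r : A ⟶ G.obj A)
    (h_coassoc : h ≫ G.δ.app A ≫ k.hom.app A = h ≫ G.map h)
    (r_counit : r ≫ G.ε.app A = 𝟙 A) (r_coassoc : r ≫ G.δ.app A = r ≫ G.map r)
    (compat : h ≫ G.map r = r ≫ G.map h ≫ k.hom.app A)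
    (bij : ∀ Z, Function.Bijective (copairing h Z))
    (inj : ∀ Z, Function.Injective (copairing (G.δ.app A ≫ k.hom.app A) Z)) :
    ∃ (X : C) (φ : A ≅ G.obj X), h ≫ G.map φ.hom = φ.hom ≫ G.δ.app X ≫ k.hom.app X ∧
      r ≫ G.map φ.hom = φ.hom ≫ G.δ.app X := by
  -- The perfect copairing represents the second coaction by `σ : G A ⟶ A`; `σ2` and `σ3` make `σ` a
  -- bicomodule morphism out of the regular bicomodule.
  obtain ⟨σ, hσ⟩ := (bij A).2 r
  have σ1 : h ≫ σ = 𝟙 A := by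
    rw [← r_counit, ← hσ]
    have a1 := G.counit_naturality _ σ
    have a2 := G.left_counit A
    simp only [copairing, Category.assoc, Functor.comp_obj, Functor.id_obj] at *
    rw [a1, reassoc_of% a2]
  have σ2 : σ ≫ h = G.δ.app A ≫ k.hom.app A ≫ G.map σ := by
    apply (bij (G.obj A)).1
    have a1 : h ≫ G.δ.app A ≫ G.map (G.δ.app A) ≫ G.map (k.hom.app A) ≫ G.map (G.map σ) =
        r ≫ G.map h := by
      rw [← cancel_mono (k.hom.app A), Category.assoc r, ← compat, ← hσ]
      have a2 := k.nat σ
      have a3 := k.comul_left A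
      have a4 := G.coassoc A
      simp only [copairing, Functor.map_comp, Category.assoc, Functor.comp_obj] at *
      rw [a2, reassoc_of% a4, ← reassoc_of% a3,
        reassoc_of% h_coassoc]
    simp only [copairing, Functor.map_comp] at *
    rw [reassoc_of% hσ, a1]
  have σ3 : σ ≫ r = G.δ.app A ≫ G.map σ := by
    apply (bij (G.obj A)).1
    have a3 := G.delta_naturality _ σ
    have a4 := G.coassoc A
    simp only [copairing, Functor.map_comp, Functor.comp_obj] at *
    rw [reassoc_of% hσ, reassoc_of% a4, ← a3, reassoc_of% hσ, r_coassoc]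
  have σ4 : G.map (G.ε.app A) ≫ σ = G.map σ ≫ σ := by
    apply inj
    have a1 := G.delta_naturality _ (G.ε.app A)
    have a2 := k.counit_left A
    have a3 := G.left_counit A
    have a4 := G.delta_naturality _ σ
    simp only [copairing, Functor.map_comp, Category.assoc, Functor.comp_obj, Functor.id_obj] at *
    rw [← reassoc_of% a1, reassoc_of% a2, reassoc_of% a3, ← reassoc_of% a4, ← reassoc_of% σ2,
      hσ, ← σ3]
  -- The idempotent `e ≫ σ` splits through the coequalizer of `ε_A` and `σ`, a quotient `q` after
  -- which the two coactions agree (`v2`).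
  have u1 : G.ε.app A ≫ e.app A ≫ σ = σ ≫ e.app A ≫ σ := by
    have a1 := e.naturality (G.ε.app A)
    have a2 := e.naturality σ
    simp only [Functor.id_obj, Functor.id_map] at *
    rw [reassoc_of% a1, reassoc_of% a2, σ4]
  have u2 : (e.app A ≫ σ) ≫ (e.app A ≫ σ) = e.app A ≫ σ := by
    have a1 := he A
    rw [Category.assoc, ← u1]
    simp only [Functor.id_obj] at *
    rw [reassoc_of% a1]
  obtain ⟨X, i, q, hi, hq⟩ := IsIdempotentComplete.idempotents_split A _ u2
  have v1 : G.ε.app A ≫ q = σ ≫ q := by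
    have : q = e.app A ≫ σ ≫ q := by rw [← reassoc_of% hq, hi, Category.comp_id]
    rw [this]
    simp only [Functor.id_obj] at u1 ⊢
    rw [reassoc_of% u1]
  have v2 : h ≫ G.map q = r ≫ G.map q := by
    have a1 := G.right_counit A
    have a2 := congrArg G.map v1
    simp only [copairing, Functor.map_comp, Functor.comp_obj, Functor.id_obj] at *
    rw [← hσ, Category.assoc, Category.assoc, ← a2, reassoc_of% a1]
  refine ⟨X, ⟨h ≫ G.map q, G.map i ≫ σ, ?_, ?_⟩, ?_, ?_⟩
  · have a1 := congrArg G.map hq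
    have a2 : G.map (e.app A) ≫ G.map (G.ε.app A) = 𝟙 (G.obj A) :=
      (G.map_comp _ _).symm.trans ((congrArg G.map (he A)).trans (G.map_id _))
    simp only [Functor.map_comp, Category.assoc, Functor.id_obj] at *
    rw [reassoc_of% a1, ← σ4, reassoc_of% a2, σ1]
  · have a1 := congrArg G.map v1
    have a2 := k.counit_left A
    have a3 := G.left_counit A
    have a4 := congrArg G.map hi
    simp only [Functor.map_comp, Category.assoc, Functor.comp_obj, Functor.id_obj] at *
    rw [reassoc_of% σ2, ← a1, reassoc_of% a2, reassoc_of% a3, a4]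
    exact G.map_id X
  · have a1 := k.nat q
    have a2 := G.delta_naturality _ q
    simp only [Functor.map_comp, Category.assoc] at *
    rw [← reassoc_of% h_coassoc, reassoc_of% a2, a1]
  · have a2 := G.delta_naturality _ q
    simp only [v2, Functor.map_comp, Category.assoc] at *
    rw [← reassoc_of% r_coassoc, a2]

/-! ### Galois with split counit implies Azumaya -/

section Galois

variable {L : Monad C} (p : AdjointPair L G)

/-- The component at a comodule of the Galois map of the cofree functor. -/
noncomputable def galoisApp (M : k.opp.Coalgebra) : L.obj M.A ⟶ G.obj M.A :=
  (((k.cofreeAction p).galoisMap k.opp.adj).app M).f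

lemma galoisApp_eq (M : k.opp.Coalgebra) (h : M.A ⟶ G.obj M.A) (hM : M.a = h) :
    k.galoisApp p M = L.map h ≫ L.map (G.δ.app M.A) ≫ p.adj.counit.app (G.obj M.A) := by
  subst hM
  have h1 : k.galoisApp p M = L.map (k.opp.adj.unit.app M).f ≫
    L.map (G.δ.app M.A) ≫ p.adj.counit.app (G.obj M.A) := rfl
  rw [h1, k.opp.adj_unit_app_f]
  rfl

/-- The transpose of the Galois map is `δ · h`, so the copairing is the transpose of precomposition
with the Galois map. -/
lemma unit_galoisApp (M : k.opp.Coalgebra) (h : M.A ⟶ G.obj M.A) (hM : M.a = h) :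
    p.adj.unit.app M.A ≫ G.map (k.galoisApp p M) = h ≫ G.δ.app M.A := by
  rw [k.galoisApp_eq p M h hM]
  have h1 := adj_unit_nat p.adj h
  have h2 := adj_unit_nat p.adj (G.δ.app M.A)
  have h3 := p.adj.right_triangle_components (G.obj M.A)
  simp only [Functor.map_comp, Functor.comp_obj, Functor.id_obj] at *
  rw [← reassoc_of% h1, ← reassoc_of% h2, h3, Category.comp_id]

lemma cofreeIsGalois_iff :
    k.CofreeIsGalois p ↔ ∀ M : k.opp.Coalgebra, IsIso (k.galoisApp p M) := by
  constructor
  · intro (H : IsIso _) M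
    exact inferInstanceAs (IsIso (k.opp.forget.map
      (((k.cofreeAction p).galoisMap k.opp.adj).app M)))
  · intro H
    have : ∀ M, IsIso (((k.cofreeAction p).galoisMap k.opp.adj).app M) := fun M => by
      have : IsIso (k.opp.forget.map (((k.cofreeAction p).galoisMap k.opp.adj).app M)) := H M
      exact isIso_of_reflects_iso _ k.opp.forget
    exact NatIso.isIso_of_isIso_app _

variable {k p}

lemma CofreeIsGalois.copairing_bijective (H : k.CofreeIsGalois p) {A : C} (h : A ⟶ G.obj A)
    (h_counit : h ≫ G.ε.app A = 𝟙 A)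
    (h_coassoc : h ≫ G.δ.app A ≫ k.hom.app A = h ≫ G.map h) (Z : C) :
    Function.Bijective (copairing h Z) := by
  let M : k.opp.Coalgebra := ⟨A, h, h_counit, h_coassoc⟩
  have : IsIso (k.galoisApp p M) := (k.cofreeIsGalois_iff p).1 H M
  have key : ∀ t : G.obj A ⟶ Z,
      copairing h Z t = p.adj.homEquiv A Z (k.galoisApp p M ≫ t) := fun t => by
    have := k.unit_galoisApp p M h rfl
    rw [Adjunction.homEquiv_unit, G.map_comp]
    exact (Category.assoc _ _ _).symm.trans
      ((congrArg (· ≫ G.map t) this.symm).trans (Category.assoc _ _ _))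
  refine ⟨fun s t hst => ?_, fun g => ⟨inv (k.galoisApp p M) ≫ (p.adj.homEquiv A Z).symm g, ?_⟩⟩
  · rw [key, key] at hst
    exact (cancel_epi (k.galoisApp p M)).1 ((p.adj.homEquiv A Z).injective hst)
  · rw [key]
    exact (congrArg (p.adj.homEquiv A Z) (by simp)).trans ((p.adj.homEquiv A Z).right_inv g)

/-- If the cofree functor is Galois and the counit splits, then `(G, κ)` is Azumaya. -/
theorem CofreeIsGalois.isAzumaya [IsIdempotentComplete C] (H : k.CofreeIsGalois p)
    (hs : IsSplitEpi G.ε) : k.IsAzumaya := by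
  obtain ⟨⟨e, he⟩⟩ := hs
  have he : ∀ X, e.app X ≫ G.ε.app X = 𝟙 X := fun X => NatTrans.congr_app he X
  have inj : ∀ Y Z, Function.Injective (copairing (G.δ.app Y ≫ k.hom.app Y) Z) := fun Y Z =>
    (H.copairing_bijective _ (k.opp.left_counit Y) (k.opp.coassoc Y).symm Z).1
  refine { faithful := ⟨fun {X Y f g} hfg => ?_⟩, full := ⟨fun {X Y} g => ?_⟩,
           essSurj := ⟨fun M => ?_⟩ }
  · have h1 : G.map f = G.map g := congrArg Comonad.Coalgebra.Hom.f hfg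
    have h2 := G.counit_naturality _ f
    have h3 := G.counit_naturality _ g
    rw [← Category.id_comp f, ← Category.id_comp g, ← he X, Category.assoc, Category.assoc,
      ← h2, ← h3, h1]
  · obtain ⟨f, hf⟩ := k.exists_map_eq_of_copairing e he (inj X) g.f (k.comparison_hom_fst g)
      (k.comparison_hom_snd g)
    exact ⟨f, Comonad.Coalgebra.Hom.ext hf⟩
  · have h_coassoc : k.oppLaw.fstCoaction M ≫ G.δ.app M.A ≫ k.hom.app M.A =
        k.oppLaw.fstCoaction M ≫ G.map (k.oppLaw.fstCoaction M) :=
      k.oppLaw.fstCoaction_coassoc M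
    obtain ⟨X, φ, h1, h2⟩ := k.exists_iso_of_copairing e he (A := M.A) (k.oppLaw.fstCoaction M)
      (k.oppLaw.sndCoaction M) h_coassoc (k.oppLaw.sndCoaction_counit M)
      (k.oppLaw.sndCoaction_coassoc M)
      ((k.oppLaw.coaction_compat M).trans
        ((congrArg (· ≫ k.hom.app M.A) (k.oppLaw.coaction_eq M).symm).trans
          (Category.assoc _ _ _)))
      (H.copairing_bijective _ (k.oppLaw.fstCoaction_counit M) h_coassoc) (inj M.A)
    let ψ : M ⟶ k.comparison.obj X := CodistribLaw.homOfPair (k := k.oppLaw) φ.hom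
      (by rw [k.fstCoaction_comparison X]; exact h1) (by rw [k.sndCoaction_comparison X]; exact h2)
    have : IsIso (k.double.forget.map ψ) := inferInstanceAs (IsIso φ.hom)
    have : IsIso ψ := isIso_of_reflects_iso ψ k.double.forget
    exact ⟨X, ⟨(asIso ψ).symm⟩⟩

end Galois

end CoBDLaw

/-! ### Azumaya comonads have Galois cofree functors -/

namespace CoBDLaw

variable {G : Comonad C} (k : CoBDLaw G) [IsIso k.hom] {L : Monad C} (p : AdjointPair L G)

/-- The coaction of `G` on its left adjoint. -/
def leftAdjointCoaction (A : C) : L.obj A ⟶ G.obj (L.obj A) :=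
  L.map (p.adj.unit.app A ≫ G.δ.app (L.obj A)) ≫ p.adj.counit.app (G.obj (L.obj A))

lemma unit_leftAdjointCoaction (A : C) :
    p.adj.unit.app A ≫ G.map (leftAdjointCoaction p A) =
      p.adj.unit.app A ≫ G.δ.app (L.obj A) := by
  have h1 := adj_unit_nat p.adj (p.adj.unit.app A ≫ G.δ.app (L.obj A))
  have h2 := p.adj.right_triangle_components (G.obj (L.obj A))
  simp only [leftAdjointCoaction, Functor.map_comp, Category.assoc, Functor.id_obj] at *
  rw [← reassoc_of% h1, h2]
  exact congrArg (p.adj.unit.app A ≫ ·) (Category.comp_id _)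

lemma leftAdjointCoaction_counit (A : C) :
    leftAdjointCoaction p A ≫ G.ε.app (L.obj A) = 𝟙 (L.obj A) := by
  apply adj_ext' p.adj
  have h1 := G.right_counit (L.obj A)
  have h2 := unit_leftAdjointCoaction p A
  simp only [Functor.map_comp, Functor.comp_obj, Functor.id_obj] at *
  rw [reassoc_of% h2, h1]
  simp

lemma leftAdjointCoaction_coassoc (A : C) :
    leftAdjointCoaction p A ≫ G.δ.app (L.obj A) =
      leftAdjointCoaction p A ≫ G.map (leftAdjointCoaction p A) := by
  apply adj_ext' p.adj
  have h1 := G.delta_naturality _ (leftAdjointCoaction p A)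
  have h2 := G.coassoc (L.obj A)
  have h3 := unit_leftAdjointCoaction p A
  simp only [Functor.map_comp, Functor.comp_obj, Functor.id_obj] at *
  rw [reassoc_of% h3, reassoc_of% h3, ← h1, reassoc_of% h3, h2]

/-- The lifted coaction of the opposite comonad on `L A`. -/
noncomputable def liftCoaction (M : k.opp.Coalgebra) : L.obj M.A ⟶ G.obj (L.obj M.A) :=
  ((k.liftMonad p).obj M).a

lemma unit_liftCoaction (M : k.opp.Coalgebra) (h : M.A ⟶ G.obj M.A) (hM : M.a = h) :
    p.adj.unit.app M.A ≫ G.map (k.liftCoaction p M) =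
      h ≫ G.map (p.adj.unit.app M.A) ≫ (inv k.hom).app (L.obj M.A) := by
  obtain ⟨w, hw⟩ : ∃ w : L.obj (G.obj M.A) ⟶ G.obj (L.obj M.A), (k.mixed p).hom.app M.A = w :=
    ⟨_, rfl⟩
  have h1 : p.adj.unit.app (G.obj M.A) ≫ G.map w =
      G.map (p.adj.unit.app M.A) ≫ (inv k.hom).app (L.obj M.A) := by
    rw [← hw]
    exact k.oppLaw.inv.mate_unit p M.A
  have h2 := adj_unit_nat p.adj h
  have h3 : k.liftCoaction p M = L.map h ≫ w := by subst hM hw; rfl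
  rw [h3, G.map_comp, ← reassoc_of% h2, h1]

/-- Transposing reduces this to naturality of `κ⁻¹` and its compatibility with `δ`; it makes `L A` a
comodule over the composite comonad. -/
lemma liftCoaction_compat (M : k.opp.Coalgebra) :
    k.liftCoaction p M ≫ G.map (leftAdjointCoaction p M.A) =
      leftAdjointCoaction p M.A ≫ G.map (k.liftCoaction p M) ≫ k.hom.app (L.obj M.A) := by
  apply adj_ext' p.adj
  obtain ⟨h, hM⟩ : ∃ h : M.A ⟶ G.obj M.A, M.a = h := ⟨_, rfl⟩
  have h1 := k.unit_liftCoaction p M h hM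
  have h2 := unit_leftAdjointCoaction p M.A
  generalize k.liftCoaction p M = χ at *
  generalize leftAdjointCoaction p M.A = r at *
  have h3 := (inv k.hom).naturality r
  have h4 := congrArg G.map h2
  have h5 : G.map (G.δ.app (L.obj M.A)) ≫ (inv k.hom).app (G.obj (L.obj M.A)) =
      (inv k.hom).app (L.obj M.A) ≫ G.δ.app (G.obj (L.obj M.A)) ≫
        G.map (k.hom.app (L.obj M.A)) := by
    rw [← cancel_mono (k.hom.app (G.obj (L.obj M.A))), ← cancel_epi (k.hom.app (L.obj M.A))]
    have := k.comul_left (L.obj M.A)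
    simp only [Functor.comp_obj] at *
    simp [this]
  have h6 := G.delta_naturality _ χ
  simp only [Functor.map_comp, Functor.comp_obj, Functor.comp_map] at *
  rw [reassoc_of% h1, ← h3, reassoc_of% h4, h5, reassoc_of% h2, ← reassoc_of% h6,
    reassoc_of% h1]

/-- The bicomodule `L A`. -/
noncomputable def leftAdjointBicomodule (M : k.opp.Coalgebra) : k.double.Coalgebra :=
  k.oppLaw.coalgebraOfPair (L.obj M.A) (leftAdjointCoaction p M.A) (k.liftCoaction p M)
    (leftAdjointCoaction_counit p M.A) (leftAdjointCoaction_coassoc p M.A)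
    ((k.liftMonad p).obj M).counit ((k.liftMonad p).obj M).coassoc (k.liftCoaction_compat p M)

lemma fstCoaction_leftAdjointBicomodule (M : k.opp.Coalgebra) :
    k.oppLaw.fstCoaction (k.leftAdjointBicomodule p M) = k.liftCoaction p M :=
  CodistribLaw.fstCoaction_coalgebraOfPair ..

lemma sndCoaction_leftAdjointBicomodule (M : k.opp.Coalgebra) :
    k.oppLaw.sndCoaction (k.leftAdjointBicomodule p M) = leftAdjointCoaction p M.A :=
  CodistribLaw.sndCoaction_coalgebraOfPair ..

lemma galoisApp_colinear (M : k.opp.Coalgebra) :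
    k.liftCoaction p M ≫ G.map (k.galoisApp p M) =
      k.galoisApp p M ≫ G.δ.app M.A ≫ k.hom.app M.A :=
  (((k.cofreeAction p).galoisMap k.opp.adj).app M).h

lemma galoisApp_colinear' (M : k.opp.Coalgebra) :
    leftAdjointCoaction p M.A ≫ G.map (k.galoisApp p M) = k.galoisApp p M ≫ G.δ.app M.A := by
  apply adj_ext' p.adj
  obtain ⟨h, hM⟩ : ∃ h : M.A ⟶ G.obj M.A, M.a = h := ⟨_, rfl⟩
  have h1 := k.unit_galoisApp p M h hM
  have h2 := unit_leftAdjointCoaction p M.A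
  generalize leftAdjointCoaction p M.A = r at *
  generalize k.galoisApp p M = g at *
  have h3 := G.delta_naturality _ g
  have h4 := G.coassoc M.A
  simp only [Functor.map_comp, Functor.comp_obj] at *
  rw [reassoc_of% h1, reassoc_of% h2, ← h3, reassoc_of% h1, h4]

/-- The Galois map as a bicomodule morphism. -/
noncomputable def galoisHom (M : k.opp.Coalgebra) :
    k.leftAdjointBicomodule p M ⟶ k.comparison.obj M.A :=
  CodistribLaw.homOfPair (k := k.oppLaw) (k.galoisApp p M)
    (by
      rw [k.fstCoaction_comparison, k.fstCoaction_leftAdjointBicomodule]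
      exact k.galoisApp_colinear p M)
    (by
      rw [k.sndCoaction_comparison, k.sndCoaction_leftAdjointBicomodule]
      exact k.galoisApp_colinear' p M)

/-- Bicomodule morphisms from `L A` to a cofree comodule factor through the Galois map. -/
lemma eq_galoisHom_comp_map (M : k.opp.Coalgebra) {X : C}
    (ψ : k.leftAdjointBicomodule p M ⟶ k.comparison.obj X) :
    ∃ s : M.A ⟶ X, ψ = k.galoisHom p M ≫ k.comparison.map s := by
  obtain ⟨f, hf⟩ : ∃ f : L.obj M.A ⟶ G.obj X, ψ.f = f := ⟨_, rfl⟩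
  have h1 : k.liftCoaction p M ≫ G.map f = f ≫ G.δ.app X ≫ k.hom.app X := by
    have := CodistribLaw.hom_fstCoaction (k := k.oppLaw) ψ
    rw [k.fstCoaction_comparison, k.fstCoaction_leftAdjointBicomodule] at this
    rw [← hf]
    exact this
  have h2 : leftAdjointCoaction p M.A ≫ G.map f = f ≫ G.δ.app X := by
    have := CodistribLaw.hom_sndCoaction (k := k.oppLaw) ψ
    rw [k.sndCoaction_comparison, k.sndCoaction_leftAdjointBicomodule] at this
    rw [← hf]
    exact this
  -- Restriction along the unit of `L` and corestriction along the counit of `G`; colinearity over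
  -- each comonad recovers `f` from this map.
  refine ⟨(L.η.app M.A ≫ f) ≫ G.ε.app X, Comonad.Coalgebra.Hom.ext (hf.trans ?_)⟩
  change f = k.galoisApp p M ≫ G.map ((L.η.app M.A ≫ f) ≫ G.ε.app X)
  obtain ⟨h, hM⟩ : ∃ h : M.A ⟶ G.obj M.A, M.a = h := ⟨_, rfl⟩
  have h3 := k.unit_galoisApp p M h hM
  have h4 := unit_leftAdjointCoaction p M.A
  have hη : h ≫ G.map (L.η.app M.A) = L.η.app M.A ≫ k.liftCoaction p M := by
    rw [← hM]
    exact ((k.liftMonad p).η.app M).h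
  generalize k.galoisApp p M = γ at *
  generalize leftAdjointCoaction p M.A = r at *
  generalize k.liftCoaction p M = χ at *
  have h5 : L.η.app M.A ≫ f = h ≫ G.map ((L.η.app M.A ≫ f) ≫ G.ε.app X) := by
    have a1 := k.counit_left X
    have a2 := G.left_counit X
    simp only [Functor.map_comp, Category.assoc, Functor.comp_obj, Functor.id_obj] at *
    rw [reassoc_of% hη, reassoc_of% h1, a1, a2, Category.comp_id]
  generalize (L.η.app M.A ≫ f) ≫ G.ε.app X = s at *
  apply adj_ext' p.adj
  have a1 := p.unit_eq M.A
  have a2 := congrArg (fun f => p.adj.unit.app M.A ≫ G.map f) h2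
  have a3 := G.delta_naturality _ f
  have a4 := G.delta_naturality _ s
  have a6 := G.counit_naturality _ (G.δ.app X)
  have a8 := G.left_counit (G.obj X)
  have a9 := G.counit_naturality _ f
  simp only [Functor.map_comp, Functor.comp_obj, Functor.id_obj] at *
  rw [reassoc_of% h4, ← a3] at a2
  rw [reassoc_of% h3, ← a4, ← reassoc_of% h5, a1, Category.assoc, ← reassoc_of% a9, ← a6,
    ← reassoc_of% a2, a8, Category.comp_id]

variable {k p}

/-- The cofree functor of an Azumaya comonad is Galois. -/
theorem IsAzumaya.cofreeIsGalois (H : k.IsAzumaya) : k.CofreeIsGalois p := by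
  have : k.comparison.IsEquivalence := H
  rw [cofreeIsGalois_iff]
  intro M
  obtain ⟨X, ⟨ψ⟩⟩ : ∃ X, Nonempty (k.leftAdjointBicomodule p M ≅ k.comparison.obj X) :=
    ⟨_, ⟨(k.comparison.objObjPreimageIso _).symm⟩⟩
  obtain ⟨s, hs⟩ := k.eq_galoisHom_comp_map p M ψ.hom
  obtain ⟨r, hr⟩ := k.comparison.map_surjective (ψ.inv ≫ k.galoisHom p M)
  have h1 : r ≫ s = 𝟙 X := by
    apply k.comparison.map_injective
    rw [Functor.map_comp, hr, Category.assoc, ← hs, ψ.inv_hom_id, CategoryTheory.Functor.map_id]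
  -- The composite fixes the Galois map; transposing that equation and applying two counits leaves
  -- `s ≫ r = 𝟙`.
  have h2 : s ≫ r = 𝟙 M.A := by
    obtain ⟨h, hM⟩ : ∃ h : M.A ⟶ G.obj M.A, M.a = h := ⟨_, rfl⟩
    have h3 : k.galoisHom p M ≫ k.comparison.map (s ≫ r) = k.galoisHom p M := by
      rw [Functor.map_comp, hr, ← Category.assoc, ← hs, ψ.hom_inv_id_assoc]
    have h4 : k.galoisApp p M ≫ G.map (s ≫ r) = k.galoisApp p M :=
      congrArg Comonad.Coalgebra.Hom.f h3
    have h5 := k.unit_galoisApp p M h hM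
    have h6 := congrArg (fun f => p.adj.unit.app M.A ≫ G.map f) h4
    have h7 : h ≫ G.ε.app M.A = 𝟙 M.A := by rw [← hM]; exact M.counit
    have a1 := G.delta_naturality _ (s ≫ r)
    have a3 := G.counit_naturality _ (s ≫ r)
    have a4 := G.left_counit M.A
    generalize s ≫ r = t at *
    simp only [Functor.map_comp, Functor.comp_obj, Functor.id_obj] at *
    rw [h5, reassoc_of% h5, ← a1] at h6
    have h8 := congrArg (fun f => (f ≫ G.ε.app (G.obj M.A)) ≫ G.ε.app M.A) h6
    simp only [Category.assoc, reassoc_of% a4, h7] at h8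
    rw [a3, reassoc_of% h7] at h8
    exact h8
  have : IsIso r := ⟨s, h1, h2⟩
  have : IsIso (k.galoisHom p M) := by
    rw [show k.galoisHom p M = ψ.hom ≫ k.comparison.map r by rw [hr]; simp]
    infer_instance
  exact inferInstanceAs (IsIso (k.double.forget.map (k.galoisHom p M)))

end CoBDLaw

/-! ### Modules over a monad and comodules over its right adjoint -/

namespace BDLaw

variable {F : Monad C} (l : BDLaw F) {R : C ⥤ C} (adj : F.toFunctor ⊣ R)

lemma transpose_unit_iff {A : C} {h : F.obj A ⟶ A} {θ : A ⟶ R.obj A}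
    (hθ : F.map θ ≫ adj.counit.app A = h) :
    F.η.app A ≫ h = 𝟙 A ↔ θ ≫ (rightAdjointComonad adj).ε.app A = 𝟙 A := by
  have h1 : (rightAdjointComonad adj).ε.app A = F.η.app (R.obj A) ≫ adj.counit.app A :=
    mate_counit_app adj A
  have h2 := F.unit_naturality _ θ
  have h3 : F.η.app A ≫ h = θ ≫ (rightAdjointComonad adj).ε.app A := by
    rw [h1, ← hθ]
    simp only [Functor.id_obj] at *
    rw [reassoc_of% h2]
  rw [h3]

/-- With `transpose_unit_iff`, this makes `F^λ`-modules and `R^κ`-comodules on `A` correspond under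
`h ↔ θ`. Transposing twice turns `δ` and `κ` back into `m` and `λ`, and the coassociativity law into
the associativity law. -/
lemma transpose_assoc_iff {A : C} {h : F.obj A ⟶ A} {θ : A ⟶ R.obj A}
    (hθ : F.map θ ≫ adj.counit.app A = h) :
    l.hom.app A ≫ F.μ.app A ≫ h = F.map h ≫ h ↔
      θ ≫ (rightAdjointComonad adj).δ.app A ≫ (l.mate adj).hom.app A = θ ≫ R.map θ := by
  obtain ⟨δ, hδ⟩ : ∃ δ : R.obj A ⟶ R.obj (R.obj A), (rightAdjointComonad adj).δ.app A = δ :=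
    ⟨_, rfl⟩
  obtain ⟨κ, hκ⟩ : ∃ κ : R.obj (R.obj A) ⟶ R.obj (R.obj A), (l.mate adj).hom.app A = κ :=
    ⟨_, rfl⟩
  have h1 : F.map (F.map δ) ≫ F.map (adj.counit.app (R.obj A)) ≫ adj.counit.app A =
      F.μ.app (R.obj A) ≫ adj.counit.app A := by
    rw [← hδ]
    exact mate_comul_counit adj A
  have h2 : F.map (F.map κ) ≫ F.map (adj.counit.app (R.obj A)) ≫ adj.counit.app A =
      l.hom.app (R.obj (R.obj A)) ≫ F.map (adj.counit.app (R.obj A)) ≫ adj.counit.app A := by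
    rw [← hκ]
    exact mate_hom_counit adj l.hom A
  have key : l.hom.app A ≫ F.μ.app A ≫ h = F.map h ≫ h ↔ θ ≫ δ ≫ κ = θ ≫ R.map θ := by
    have e1 : F.map (F.map (θ ≫ δ ≫ κ)) ≫ F.map (adj.counit.app (R.obj A)) ≫ adj.counit.app A =
        l.hom.app A ≫ F.μ.app A ≫ h := by
      have a1 := l.nat δ
      have a2 := l.nat θ
      have a3 := F.mu_naturality _ θ
      simp only [Functor.map_comp, Category.assoc, Functor.comp_obj, Functor.id_obj] at *
      rw [h2, reassoc_of% a1, h1, reassoc_of% a2, reassoc_of% a3, hθ]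
    have e2 : F.map (F.map (θ ≫ R.map θ)) ≫ F.map (adj.counit.app (R.obj A)) ≫
        adj.counit.app A = F.map h ≫ h := by
      have a1 := congrArg F.map (adj_counit_nat adj θ)
      have a2 := congrArg F.map hθ
      simp only [Functor.map_comp, Category.assoc, Functor.comp_obj, Functor.id_obj] at *
      rw [reassoc_of% a1, hθ, reassoc_of% a2]
    constructor
    · intro H
      apply adj_ext_two adj
      rw [e1, e2, H]
    · intro H
      rw [← e1, ← e2, H]
  rw [key, ← hδ, ← hκ]
  rfl

variable [IsIso l.hom]

/-- Both maps `F A ⟶ R A` have transpose `h · m`; on the comodule side this holds because `δ` is the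
mate of `m`. -/
lemma galoisApp_mk_eq_galoisApp_mk {A : C} {h : F.obj A ⟶ A} {θ : A ⟶ R.obj A}
    (hθ : F.map θ ≫ adj.counit.app A = h) (h1 : l.opp.η.app A ≫ h = 𝟙 A)
    (h2 : l.opp.μ.app A ≫ h = l.opp.map h ≫ h)
    (h3 : θ ≫ (l.mate adj).opp.ε.app A = 𝟙 A)
    (h4 : θ ≫ (l.mate adj).opp.δ.app A = θ ≫ (l.mate adj).opp.map θ) :
    l.galoisApp (AdjointPair.ofAdj adj) ⟨A, h, h1, h2⟩ =
      (l.mate adj).galoisApp (AdjointPair.ofAdj adj) ⟨A, θ, h3, h4⟩ := by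
  apply adj_ext adj
  have e1 := l.galoisApp_counit (AdjointPair.ofAdj adj) ⟨A, h, h1, h2⟩ h rfl
  refine e1.trans ?_
  rw [(l.mate adj).galoisApp_eq (AdjointPair.ofAdj adj) ⟨A, θ, h3, h4⟩ θ rfl]
  obtain ⟨δ, hδ⟩ : ∃ δ : R.obj A ⟶ R.obj (R.obj A), (rightAdjointComonad adj).δ.app A = δ :=
    ⟨_, rfl⟩
  have e2 : F.map (F.map δ) ≫ F.map (adj.counit.app (R.obj A)) ≫ adj.counit.app A =
      F.μ.app (R.obj A) ≫ adj.counit.app A := by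
    rw [← hδ]
    exact mate_comul_counit adj A
  dsimp only
  rw [hδ]
  change _ = F.map (F.map θ ≫ F.map δ ≫ adj.counit.app (R.obj A)) ≫ adj.counit.app A
  have e3 := F.mu_naturality _ θ
  simp only [Functor.map_comp, Category.assoc, Functor.comp_obj, Functor.id_obj] at *
  rw [e2, reassoc_of% e3, hθ]

/-- The free functor of `F^λ` is Galois if and only if the cofree functor of `R^κ` is. -/
theorem freeIsGalois_iff_cofreeIsGalois :
    l.FreeIsGalois (AdjointPair.ofAdj adj) ↔
      (l.mate adj).CofreeIsGalois (AdjointPair.ofAdj adj) := by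
  rw [freeIsGalois_iff, CoBDLaw.cofreeIsGalois_iff]
  constructor
  · rintro H ⟨A, θ, h3, h4⟩
    obtain ⟨h, hθ⟩ : ∃ h : F.obj A ⟶ A, F.map θ ≫ adj.counit.app A = h := ⟨_, rfl⟩
    have h1 : l.opp.η.app A ≫ h = 𝟙 A := (transpose_unit_iff adj hθ).2 h3
    have h2 : l.opp.μ.app A ≫ h = l.opp.map h ≫ h :=
      (Category.assoc _ _ _).trans ((l.transpose_assoc_iff adj hθ).2 h4)
    have := H ⟨A, h, h1, h2⟩
    rwa [l.galoisApp_mk_eq_galoisApp_mk adj hθ h1 h2 h3 h4] at this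
  · rintro H ⟨A, h, h1, h2⟩
    obtain ⟨θ, hθ⟩ : ∃ θ : A ⟶ R.obj A, F.map θ ≫ adj.counit.app A = h :=
      ⟨adj.homEquiv A A h, (adj.homEquiv_counit ..).symm.trans ((adj.homEquiv A A).left_inv h)⟩
    have h3 : θ ≫ (l.mate adj).opp.ε.app A = 𝟙 A := (transpose_unit_iff adj hθ).1 h1
    have h4 : θ ≫ (l.mate adj).opp.δ.app A = θ ≫ (l.mate adj).opp.map θ :=
      (l.transpose_assoc_iff adj hθ).1 ((Category.assoc _ _ _).symm.trans h2)
    have := H ⟨A, θ, h3, h4⟩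
    rwa [← l.galoisApp_mk_eq_galoisApp_mk adj hθ h1 h2 h3 h4] at this

end BDLaw

end AzumayaMonad

/-! ### The six equivalent conditions -/

theorem mainTheorem2 {C : Type u} [Category.{v} C] [IsIdempotentComplete C]
    (F : CategoryTheory.Monad C) (l : AzumayaMonad.BDLaw F) [IsIso l.hom]
    (R : C ⥤ C) (adj : F.toFunctor ⊣ R) :
    List.TFAE
      [ l.IsAzumaya ∧ AzumayaMonad.IsSeparableMonad l.double,
        l.IsAzumaya ∧ IsSplitMono F.η,
        l.FreeIsGalois (AzumayaMonad.AdjointPair.ofAdj adj) ∧ IsSplitMono F.η,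
        (l.mate adj).IsAzumaya ∧ IsSplitEpi (AzumayaMonad.rightAdjointComonad adj).ε,
        (l.mate adj).CofreeIsGalois (AzumayaMonad.AdjointPair.ofAdj adj) ∧
          IsSplitEpi (AzumayaMonad.rightAdjointComonad adj).ε,
        (l.mate adj).IsAzumaya ∧ AzumayaMonad.IsSeparableComonad (l.mate adj).double ] := by
  tfae_have 1 ↔ 2 := and_congr_right fun h => h.isSeparableMonad_iff
  -- The splitting is used only from Galois to Azumaya, to cut out the centralizer and to descend
  -- morphisms.
  tfae_have 2 ↔ 3 := ⟨fun h => ⟨h.1.freeIsGalois, h.2⟩, fun h => ⟨h.1.isAzumaya h.2, h.2⟩⟩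
  -- The bridge between the monad and the comonad conditions, by transposition and mates.
  tfae_have 3 ↔ 5 := and_congr (l.freeIsGalois_iff_cofreeIsGalois adj)
    (AzumayaMonad.AdjointPair.ofAdj adj).isSplitMono_iff_isSplitEpi
  tfae_have 4 ↔ 5 := ⟨fun h => ⟨h.1.cofreeIsGalois, h.2⟩, fun h => ⟨h.1.isAzumaya h.2, h.2⟩⟩
  tfae_have 6 ↔ 4 := and_congr_right fun h => h.isSeparableComonad_iff
  tfae_finish
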